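/- Let $G$ be a finite simple graph on $n\ge 2$ vertices, and let $\lambda_1\ge\lambda_2\ge\dots\ge\lambda_n$ be the eigenvalues of its adjacency matrix, counted with multiplicity. For an integer $d\ge 0$ and a real number $\lambda$, call $G$ an $(n,d,\lambda)$-graph if $G$ is $d$-regular and $\max\{|\lambda_2|,|\lambda_n|\}\le\lambda$. Theorem. There exists a positive integer $d_0$ such that the following holds for every integer $d\ge d_0$ and every even integer $n\ge d+1$. Let $\lambda\le d/12$ be a real number, and let $G$ be an $(n,d,\lambda)$-graph on the vertex set $[n]=\{1,\dots,n\}$. Then there are an integer $k\le\log_2 d+36$ and spanning subgraphs $H_1,\dots,H_k$ of $G$ such that each $H_i$ is bipartite and regular (of some degree $r_i$, which may depend on $i$), and every edge of $G$ belongs to exactly one of $H_1,\dots,H_k$. -/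

import Mathlib

namespace RegBip

open Classical in
/-- The real adjacency matrix of a finite simple graph. -/
noncomputable def adjacencyMatrix {V : Type*} (G : SimpleGraph V) : Matrix V V ℝ :=
  G.adjMatrix ℝ

theorem adjacencyMatrix_isHermitian {V : Type*} (G : SimpleGraph V) :
    (adjacencyMatrix G).IsHermitian := by
  classical
  unfold adjacencyMatrix Matrix.IsHermitian
  rw [Matrix.conjTranspose_eq_transpose_of_trivial, SimpleGraph.transpose_adjMatrix]

open Classical in
/-- The `i`-th largest eigenvalue of the adjacency matrix of `G`, counted with multiplicity and
indexed from `1`, so that `adjacencyEigenvalue G 1 ≥ adjacencyEigenvalue G 2 ≥ ⋯`. The value is `0`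
if `i` is not between `1` and the number of vertices. -/
noncomputable def adjacencyEigenvalue {V : Type*} [Fintype V] (G : SimpleGraph V) (i : ℕ) : ℝ :=
  if h : 1 ≤ i ∧ i ≤ Fintype.card V then
    (adjacencyMatrix_isHermitian G).eigenvalues₀ ⟨i - 1, by omega⟩
  else 0

/-- `λ(G) = max {|λ₂|, |λₙ|}`, where `n` is the number of vertices. -/
noncomputable def secondEigenvalue {V : Type*} [Fintype V] (G : SimpleGraph V) : ℝ :=
  max |adjacencyEigenvalue G 2| |adjacencyEigenvalue G (Fintype.card V)|

open Classical in
/-- `G` is `d`-regular: every vertex has exactly `d` neighbours. -/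
def IsRegularGraph {V : Type*} [Fintype V] (G : SimpleGraph V) (d : ℕ) : Prop :=
  G.IsRegularOfDegree d

/-- `G` is an `(n, d, lam)`-graph. -/
structure IsNDLambdaGraph {V : Type*} [Fintype V] (G : SimpleGraph V) (n d : ℕ) (lam : ℝ) :
    Prop where
  card_eq : Fintype.card V = n
  regular : IsRegularGraph G d
  secondEigenvalue_le : secondEigenvalue G ≤ lam

/-- The graphs `H 0, …, H (k - 1)`, all on the full vertex set of `G` (so that they are spanning),
form a decomposition of `G` into regular bipartite spanning subgraphs: each one is a regular
bipartite subgraph of `G`, where different ones may have different degrees, and every edge of `G`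
is an edge of exactly one of them. -/
structure IsRegularBipartiteDecomposition {V : Type*} [Fintype V] (G : SimpleGraph V)
    {k : ℕ} (H : Fin k → SimpleGraph V) : Prop where
  le : ∀ i, H i ≤ G
  bipartite : ∀ i, (H i).IsBipartite
  regular : ∀ i, ∃ r : ℕ, IsRegularGraph (H i) r
  edgeDisjoint : ∀ i j, i ≠ j → Disjoint (H i).edgeSet (H j).edgeSet
  cover : ⋃ i, (H i).edgeSet = G.edgeSet

end RegBip

/-! Since `n` is even, the vertices can be grouped into pairs. A bipartition `x` and a sequence of
bipartitions `β 0, β 1, …` are chosen so that partners always lie on opposite sides. Swapping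
partners then exchanges opposite quadrants of `x` and `β l`, which therefore have equal size. An
edge inside a side of `x` is put into `F l` for the first `l` at which `β l` separates its ends.
Suppose that each `F l` can be completed to a regular graph by edges crossing both `x` and `β l`,
disjointly for different `l`. Each completed piece is bipartite along `β l`, and what remains of `G`
is regular and crosses `x`, so it is the last piece.

The degrees within each `F l` must be nearly constant, with total deviation at most a small fraction
of `d`. The bipartition `x` and the first 19 of the `β l` are random bits: a Chernoff bound and the
local lemma (`exists_even_split`) make every vertex see all bit patterns about equally often. The
later bipartitions come from locally maximal cuts on the set of pairs (`exists_iterated_halving`).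
They halve a bound on the uncut degrees each time, so about `log₂ d` of them suffice and their
deviations sum geometrically.

The completing graphs have prescribed, nearly constant degrees. They exist by a Hall-type criterion
(`exists_subgraph_deg_eq`), whose cut condition follows from the expander mixing lemma
(`cut_condition_of_isMixing`) even after a graph of small maximum degree is deleted. The demands on
opposite quadrants must have equal sums. This requires `F l` to have equal degree sums on the two
sides of `x`, which is arranged by moving a few edges from `F 0` into the other pieces
(`LevelSystem.exists_decomposition`). -/

open Finset

namespace RegBip

/-! ### Degrees into vertex sets and edge counts. -/

section Degrees

variable {V : Type*}

open Classical in
/-- The number of neighbours of `v` in `T`. -/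
noncomputable def degIn (H : SimpleGraph V) (v : V) (T : Finset V) : ℕ :=
  #{u ∈ T | H.Adj v u}

/-- The number of neighbours of `v`. -/
noncomputable def deg [Fintype V] (H : SimpleGraph V) (v : V) : ℕ :=
  degIn H v univ

/-- The number of pairs `(v, u)` in `S × T` with `v` adjacent to `u`. -/
noncomputable def edgesBetween (H : SimpleGraph V) (S T : Finset V) : ℕ :=
  ∑ v ∈ S, degIn H v T

theorem edgesBetween_comm (H : SimpleGraph V) (S T : Finset V) :
    edgesBetween H S T = edgesBetween H T S := by
  classical
  have := Finset.sum_card_bipartiteAbove_eq_sum_card_bipartiteBelow (s := S) (t := T) H.Adj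
  simp only [bipartiteAbove, bipartiteBelow] at this
  unfold edgesBetween degIn
  simp only [H.adj_comm] at this ⊢
  convert this using 3

theorem degIn_mono {H H' : SimpleGraph V} (h : H ≤ H') (v : V) {T T' : Finset V} (hT : T ⊆ T') :
    degIn H v T ≤ degIn H' v T' := by
  classical
  unfold degIn
  refine card_le_card fun u hu => ?_
  simp only [mem_filter] at hu ⊢
  exact ⟨hT hu.1, h hu.2⟩

theorem degIn_le_deg [Fintype V] (H : SimpleGraph V) (v : V) (T : Finset V) :
    degIn H v T ≤ deg H v :=
  degIn_mono le_rfl v (subset_univ T)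

theorem deg_mono [Fintype V] {H H' : SimpleGraph V} (h : H ≤ H') (v : V) : deg H v ≤ deg H' v :=
  degIn_mono h v subset_rfl

theorem degIn_union [DecidableEq V] (H : SimpleGraph V) (v : V) {S T : Finset V}
    (h : Disjoint S T) : degIn H v (S ∪ T) = degIn H v S + degIn H v T := by
  classical
  unfold degIn
  rw [filter_union, card_union_of_disjoint]
  exact disjoint_filter_filter h

theorem degIn_sup {H H' : SimpleGraph V} (h : Disjoint H H') (v : V) (T : Finset V) :
    degIn (H ⊔ H') v T = degIn H v T + degIn H' v T := by
  classical
  unfold degIn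
  simp only [SimpleGraph.sup_adj]
  rw [filter_or, card_union_of_disjoint]
  rw [disjoint_filter]
  intro u _ h1 h2
  have := h.le_bot (show (H ⊓ H').Adj v u from ⟨h1, h2⟩)
  simp at this

theorem degIn_sdiff_add {H H' : SimpleGraph V} (h : H' ≤ H) (v : V) (T : Finset V) :
    degIn (H \ H') v T + degIn H' v T = degIn H v T := by
  rw [← degIn_sup disjoint_sdiff_self_left, sdiff_sup_cancel h]

theorem degIn_le_sdiff_add (H H' : SimpleGraph V) (v : V) (T : Finset V) :
    degIn H v T ≤ degIn (H \ H') v T + degIn H' v T := by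
  have := degIn_sdiff_add (inf_le_left : H ⊓ H' ≤ H) v T
  rw [sdiff_inf_self_left] at this
  have h2 := degIn_mono (inf_le_right : H ⊓ H' ≤ H') v (subset_refl T)
  omega

theorem deg_sup [Fintype V] {H H' : SimpleGraph V} (h : Disjoint H H') (v : V) :
    deg (H ⊔ H') v = deg H v + deg H' v :=
  degIn_sup h v _

theorem deg_sdiff_add [Fintype V] {H H' : SimpleGraph V} (h : H' ≤ H) (v : V) :
    deg (H \ H') v + deg H' v = deg H v :=
  degIn_sdiff_add h v _

@[simp] theorem deg_bot [Fintype V] (v : V) : deg (⊥ : SimpleGraph V) v = 0 := by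
  simp [deg, degIn]

theorem isRegularGraph_iff [Fintype V] (H : SimpleGraph V) (r : ℕ) :
    IsRegularGraph H r ↔ ∀ v, deg H v = r := by
  classical
  unfold IsRegularGraph SimpleGraph.IsRegularOfDegree deg degIn
  refine forall_congr' fun v => ?_
  rw [← SimpleGraph.card_neighborFinset_eq_degree, SimpleGraph.neighborFinset_eq_filter]

theorem degIn_congr_inter [DecidableEq V] (H : SimpleGraph V) (v : V) {S T : Finset V}
    (h : ∀ u, H.Adj v u → (u ∈ S ↔ u ∈ T)) : degIn H v S = degIn H v T := by
  classical
  unfold degIn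
  congr 1
  ext u
  simp only [mem_filter]
  constructor <;> rintro ⟨h1, h2⟩ <;> have := h u h2 <;> tauto

end Degrees

/-! ### The expander mixing lemma. -/

section Mixing

variable {n : ℕ}

open Matrix

/-- `eigenvalues` is the sorted list `eigenvalues₀` transported to the vertex set along a bijection.
Excluding the index of the largest eigenvalue leaves values between the last and the second, and
these two are what `secondEigenvalue` controls. -/
theorem abs_eigenvalues_le (hn : 2 ≤ n) (G : SimpleGraph (Fin n))
    (j : Fin n)
    (hj : (Fintype.equivOfCardEq (Fintype.card_fin _)).symm j ≠
      (⟨0, by simp; omega⟩ : Fin (Fintype.card (Fin n)))) :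
    |(adjacencyMatrix_isHermitian G).eigenvalues j| ≤ secondEigenvalue G := by
  unfold IsHermitian.eigenvalues
  set i := (Fintype.equivOfCardEq (Fintype.card_fin _)).symm j with hi
  have hc : Fintype.card (Fin n) = n := Fintype.card_fin n
  have hanti := (adjacencyMatrix_isHermitian G).eigenvalues₀_antitone
  have h2 : adjacencyEigenvalue G 2 =
      (adjacencyMatrix_isHermitian G).eigenvalues₀ ⟨1, by omega⟩ := by
    unfold adjacencyEigenvalue
    rw [dif_pos (by omega)]
    rfl
  have hN : adjacencyEigenvalue G (Fintype.card (Fin n)) =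
      (adjacencyMatrix_isHermitian G).eigenvalues₀ ⟨n - 1, by omega⟩ := by
    unfold adjacencyEigenvalue
    rw [dif_pos (by omega)]
    congr 2
    omega
  have hi0 : i.1 ≠ 0 := fun h => hj (Fin.ext h)
  have hlt := i.2
  have hle1 : (adjacencyMatrix_isHermitian G).eigenvalues₀ i ≤ adjacencyEigenvalue G 2 := by
    rw [h2]; exact hanti (Fin.mk_le_of_le_val (by omega))
  have hle2 : adjacencyEigenvalue G (Fintype.card (Fin n)) ≤
      (adjacencyMatrix_isHermitian G).eigenvalues₀ i := by
    rw [hN]; exact hanti (Fin.le_def.2 (by simp; omega))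
  unfold secondEigenvalue
  rw [abs_le]
  constructor
  · have := neg_abs_le (adjacencyEigenvalue G (Fintype.card (Fin n)))
    have := le_max_right |adjacencyEigenvalue G 2| |adjacencyEigenvalue G (Fintype.card (Fin n))|
    linarith
  · have := le_abs_self (adjacencyEigenvalue G 2)
    have := le_max_left |adjacencyEigenvalue G 2| |adjacencyEigenvalue G (Fintype.card (Fin n))|
    linarith

theorem adjacencyMatrix_mulVec_indicator (G : SimpleGraph (Fin n)) (T : Finset (Fin n))
    (v : Fin n) :
    (adjacencyMatrix G *ᵥ fun u => if u ∈ T then (1 : ℝ) else 0) v = degIn G v T := by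
  classical
  unfold adjacencyMatrix degIn mulVec dotProduct
  simp only [SimpleGraph.adjMatrix_apply, mul_ite, mul_one, mul_zero]
  rw [Finset.card_filter, Finset.sum_ite_mem, univ_inter]
  push_cast
  rfl

/-- On vectors orthogonal to the constants, the adjacency matrix contracts by `λ(G)`. -/
theorem norm_mulVec_le_of_sum_eq_zero (hn : 2 ≤ n) (G : SimpleGraph (Fin n)) {d : ℕ}
    (hreg : ∀ v, deg G v = d) {l : ℝ} (hl : secondEigenvalue G ≤ l) (hld : l < d)
    (x : EuclideanSpace ℝ (Fin n)) (hx : ∑ i, x i = 0) :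
    ‖(WithLp.toLp 2 (adjacencyMatrix G *ᵥ x) : EuclideanSpace ℝ (Fin n))‖ ≤ l * ‖x‖ := by
  have hA := adjacencyMatrix_isHermitian G
  set b := hA.eigenvectorBasis with hb
  set j0 : Fin n := (Fintype.equivOfCardEq (Fintype.card_fin _))
    (⟨0, by simp; omega⟩ : Fin (Fintype.card (Fin n))) with hj0
  have hl0 : 0 ≤ l := le_trans (le_trans (abs_nonneg _) (le_max_left _ _)) hl
  have hev : ∀ j, j ≠ j0 → |hA.eigenvalues j| ≤ l := by
    intro j hj
    refine (abs_eigenvalues_le hn G j ?_).trans hl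
    intro h
    apply hj
    rw [hj0, ← h, Equiv.apply_symm_apply]
  have hinner : ∀ (y : EuclideanSpace ℝ (Fin n)) j,
      inner ℝ (b j) (WithLp.toLp 2 (adjacencyMatrix G *ᵥ y) : EuclideanSpace ℝ (Fin n)) =
        hA.eigenvalues j * inner ℝ (b j) y := by
    intro y j
    have h1 := hA.mulVec_eigenvectorBasis j
    rw [← hb] at h1
    have hsymm : (adjacencyMatrix G)ᵀ = adjacencyMatrix G := by
      have := hA.eq
      rwa [conjTranspose_eq_transpose_of_trivial] at this
    simp only [EuclideanSpace.inner_eq_star_dotProduct, star_trivial]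
    rw [dotProduct_comm, dotProduct_mulVec, ← mulVec_transpose, hsymm, h1, smul_dotProduct,
      smul_eq_mul, dotProduct_comm]
  let e : EuclideanSpace ℝ (Fin n) := WithLp.toLp 2 fun _ => 1
  have hAe : (WithLp.toLp 2 (adjacencyMatrix G *ᵥ e) : EuclideanSpace ℝ (Fin n)) =
      (d : ℝ) • e := by
    ext v
    have := adjacencyMatrix_mulVec_indicator G univ v
    simp only [mem_univ, if_true] at this
    have h2 := hreg v
    unfold deg at h2
    simp only [e, PiLp.smul_apply, smul_eq_mul, mul_one]
    rw [this, h2]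
  -- The all-ones vector is an eigenvector for `d`, while every index other than `j0` has eigenvalue
  -- at most `l < d`. Hence it is orthogonal to all basis vectors but `b j0`, and a vector
  -- orthogonal to it has no component along `b j0`.
  have he : ∀ j, j ≠ j0 → inner ℝ (b j) e = 0 := by
    intro j hj
    have h1 := hinner e j
    rw [hAe, inner_smul_right] at h1
    have h2 : ((d : ℝ) - hA.eigenvalues j) * inner ℝ (b j) e = 0 := by linarith
    rcases mul_eq_zero.1 h2 with h | h
    · have := le_trans (le_abs_self _) (hev j hj)
      linarith
    · exact h
  have hx0 : inner ℝ (b j0) x = 0 := by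
    have hsum : ∑ j, inner ℝ e (b j) * inner ℝ (b j) x = inner ℝ e x := b.sum_inner_mul_inner e x
    have hex : inner ℝ e x = 0 := by
      simp [EuclideanSpace.inner_eq_star_dotProduct, dotProduct, e, hx]
    rw [hex, Finset.sum_eq_single j0] at hsum
    · rcases mul_eq_zero.1 hsum with h | h
      · exfalso
        have hz : ∀ j, inner ℝ (b j) e = 0 := by
          intro j
          by_cases hj : j = j0
          · rw [hj, real_inner_comm]; exact h
          · exact he j hj
        have he0 : e = 0 := by
          rw [← b.sum_repr e]
          simp [b.repr_apply_apply, hz]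
        have := congrArg (fun y : EuclideanSpace ℝ (Fin n) => y ⟨0, by omega⟩) he0
        simp [e] at this
      · exact h
    · intro j _ hj
      rw [real_inner_comm, he j hj, zero_mul]
    · simp
  have hsq : ‖(WithLp.toLp 2 (adjacencyMatrix G *ᵥ x) : EuclideanSpace ℝ (Fin n))‖ ^ 2 ≤
      (l * ‖x‖) ^ 2 := by
    rw [mul_pow, ← b.sum_sq_norm_inner_right x, ← b.sum_sq_norm_inner_right, Finset.mul_sum]
    refine Finset.sum_le_sum fun j _ => ?_
    rw [hinner, norm_mul, mul_pow]
    by_cases hj : j = j0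
    · rw [hj, hx0]; simp
    · refine mul_le_mul_of_nonneg_right ?_ (sq_nonneg _)
      exact pow_le_pow_left₀ (norm_nonneg _) (hev j hj) 2
  exact le_of_sq_le_sq hsq (by positivity)

/-- The expander mixing lemma. -/
theorem expander_mixing (hn : 2 ≤ n) (G : SimpleGraph (Fin n)) {d : ℕ}
    (hreg : ∀ v, deg G v = d) {l : ℝ} (hl : secondEigenvalue G ≤ l) (hld : l < d)
    (S T : Finset (Fin n)) :
    |(edgesBetween G S T : ℝ) - d * #S * #T / n| ≤ l * √(#S * #T) := by
  classical
  have hn0 : (0 : ℝ) < n := by exact_mod_cast (by omega : 0 < n)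
  -- Centring one of the two indicators is enough: pairing its image with the indicator of `T`
  -- already gives the deviation.
  let x : EuclideanSpace ℝ (Fin n) := WithLp.toLp 2 fun u => (if u ∈ S then (1 : ℝ) else 0) - #S / n
  let y : EuclideanSpace ℝ (Fin n) := WithLp.toLp 2 fun u => (if u ∈ T then (1 : ℝ) else 0)
  have hx : ∑ i, x i = 0 := by
    simp only [x, sum_sub_distrib, sum_const, card_univ, Fintype.card_fin, nsmul_eq_mul,
      sum_ite_mem, univ_inter]
    field_simp
    simp
  have hl0 : 0 ≤ l := le_trans (le_trans (abs_nonneg _) (le_max_left _ _)) hl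
  have hAx := norm_mulVec_le_of_sum_eq_zero hn G hreg hl hld x hx
  have hcs := abs_real_inner_le_norm y
    (WithLp.toLp 2 (adjacencyMatrix G *ᵥ x) : EuclideanSpace ℝ (Fin n))
  have hny : ‖y‖ = √(#T) := by
    rw [EuclideanSpace.norm_eq]
    congr 1
    simp [y]
  have hnx : ‖x‖ ≤ √(#S) := by
    rw [EuclideanSpace.norm_eq]
    apply Real.sqrt_le_sqrt
    have : ∀ i, ‖x i‖ ^ 2 = (if i ∈ S then (1 : ℝ) - 2 * (#S / n) else 0) + (#S / n) ^ 2 := by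
      intro i
      simp only [x, Real.norm_eq_abs, sq_abs]
      split_ifs <;> ring
    simp only [this, sum_add_distrib, sum_ite_mem, univ_inter, sum_const, card_univ,
      Fintype.card_fin, nsmul_eq_mul]
    have h3 : (#S : ℝ) * (1 - 2 * (#S / n)) + n * (#S / n) ^ 2 = #S - (#S : ℝ) ^ 2 / n := by
      field_simp; ring
    rw [h3]
    have : 0 ≤ (#S : ℝ) ^ 2 / n := by positivity
    linarith
  have hinner : inner ℝ y (WithLp.toLp 2 (adjacencyMatrix G *ᵥ x) : EuclideanSpace ℝ (Fin n)) =
      (edgesBetween G S T : ℝ) - d * #S * #T / n := by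
    have hvec : adjacencyMatrix G *ᵥ x = fun v => (degIn G v S : ℝ) - d * (#S / n) := by
      have hx' : (x : Fin n → ℝ) = (fun u => if u ∈ S then (1 : ℝ) else 0) -
          ((#S : ℝ) / n) • (fun u => if u ∈ (univ : Finset (Fin n)) then (1 : ℝ) else 0) := by
        ext u; simp [x]
      rw [hx', mulVec_sub, mulVec_smul]
      ext v
      simp only [Pi.sub_apply, Pi.smul_apply, smul_eq_mul, adjacencyMatrix_mulVec_indicator]
      have h2 := hreg v
      unfold deg at h2
      rw [h2]
      ring
    rw [hvec]
    simp only [EuclideanSpace.inner_eq_star_dotProduct, star_trivial, dotProduct, y, mul_ite,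
      mul_one, mul_zero, sum_ite_mem, univ_inter, sum_sub_distrib, sum_const, nsmul_eq_mul]
    rw [edgesBetween_comm]
    unfold edgesBetween
    push_cast
    ring
  rw [hinner, hny] at hcs
  refine hcs.trans ?_
  have h4 : √((#S : ℝ) * #T) = √(#T) * √(#S) := by
    rw [mul_comm, Real.sqrt_mul (by positivity)]
  rw [h4]
  calc √(#T) * ‖(WithLp.toLp 2 (adjacencyMatrix G *ᵥ x) : EuclideanSpace ℝ (Fin n))‖
      ≤ √(#T) * (l * √(#S)) := by gcongr; exact hAx.trans (by gcongr)
    _ = _ := by ring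

end Mixing

end RegBip

namespace RegBip

/-! ### Bipartite subgraphs with prescribed degrees. -/

section Factor

variable {V : Type*} [Fintype V]

theorem sum_deg_eq_sum_deg [DecidableEq V] (H : SimpleGraph V) (A B : Finset V)
    (hA : ∀ v ∈ A, ∀ u, H.Adj v u → u ∈ B) (hB : ∀ v ∈ B, ∀ u, H.Adj v u → u ∈ A) :
    ∑ v ∈ A, deg H v = ∑ v ∈ B, deg H v := by
  have h := edgesBetween_comm H A B
  unfold edgesBetween at h
  have h1 : ∀ v ∈ A, deg H v = degIn H v B := fun v hv =>
    degIn_congr_inter H v fun u hu => by simpa using hA v hv u hu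
  have h2 : ∀ v ∈ B, deg H v = degIn H v A := fun v hv =>
    degIn_congr_inter H v fun u hu => by simpa using hB v hv u hu
  rw [sum_congr rfl h1, sum_congr rfl h2, h]

theorem sum_deg_eq_of_crossing [DecidableEq V] (H : SimpleGraph V) (x : V → Bool)
    (hx : ∀ u v, H.Adj u v → x u ≠ x v) :
    ∑ v with x v = true, deg H v = ∑ v with x v = false, deg H v := by
  refine sum_deg_eq_sum_deg H _ _ ?_ ?_ <;>
  · intro v hv u hu
    have := hx v u hu
    simp only [mem_filter, mem_univ, true_and] at hv ⊢
    simp_all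

/-- A bipartite graph satisfying the cut condition has a subgraph with prescribed degrees. -/
theorem exists_subgraph_deg_eq [DecidableEq V] (H : SimpleGraph V) (x : V → Bool)
    (hx : ∀ u v, H.Adj u v → x u ≠ x v) (f : V → ℕ)
    (hsum : ∑ v with x v = true, f v = ∑ v with x v = false, f v)
    (hcut : ∀ S T : Finset V, (∀ v ∈ S, x v = true) → (∀ v ∈ T, x v = false) →
      ∑ v ∈ T, f v ≤ ∑ v ∈ (univ.filter fun v => x v = true) \ S, f v + edgesBetween H S T) :
    ∃ H' ≤ H, ∀ v, deg H' v = f v := by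
  classical
  set X : Finset V := univ.filter fun v => x v = true with hX
  set Y : Finset V := univ.filter fun v => x v = false with hY
  have hfle : ∀ q ∈ Y, f q ≤ deg H q := by
    intro q hq
    have h1 := hcut X {q} (by simp [hX]) (by simpa [hY] using hq)
    rw [Finset.sdiff_self, sum_empty, zero_add, sum_singleton, edgesBetween_comm] at h1
    unfold edgesBetween at h1
    rw [sum_singleton] at h1
    exact h1.trans (degIn_le_deg H q X)
  -- Hall's theorem assigns each edge to a slot at one of its ends. A vertex of `X` has `f v` slots
  -- for kept edges, and a vertex of `Y` has `deg H v - f v` slots for discarded ones.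
  let E : Finset (V × V) := (X ×ˢ Y).filter fun e => H.Adj e.1 e.2
  let slots : V → Finset (V × ℕ) := fun v =>
    {v} ×ˢ range (if x v = true then f v else deg H v - f v)
  have hslots_mem : ∀ v (a : V × ℕ), a ∈ slots v ↔
      a.1 = v ∧ a.2 < if x v = true then f v else deg H v - f v := by
    rintro v ⟨a, k⟩; simp [slots]; aesop
  have hslots_card : ∀ v, #(slots v) = if x v = true then f v else deg H v - f v := by
    intro v; simp [slots]
  have hall : ∀ s : Finset E, #s ≤ #(s.biUnion fun e => slots e.1.1 ∪ slots e.1.2) := by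
    intro s
    let S : Finset V := s.image fun e => e.1.1
    let T : Finset V := s.image fun e => e.1.2
    have hSX : ∀ v ∈ S, v ∈ X := by
      intro v hv
      obtain ⟨e, _, rfl⟩ := mem_image.1 hv
      exact (mem_product.1 (mem_filter.1 e.2).1).1
    have hTY : ∀ v ∈ T, v ∈ Y := by
      intro v hv
      obtain ⟨e, _, rfl⟩ := mem_image.1 hv
      exact (mem_product.1 (mem_filter.1 e.2).1).2
    have hST : Disjoint S T := by
      rw [disjoint_left]
      intro v h1 h2
      have a1 := hSX v h1
      have a2 := hTY v h2
      simp [hX, hY] at a1 a2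
      simp [a1] at a2
    have hbU : (s.biUnion fun e => slots e.1.1 ∪ slots e.1.2) = (S ∪ T).biUnion slots := by
      ext a
      simp only [mem_biUnion, mem_union, S, T, mem_image]
      constructor
      · rintro ⟨e, he, h | h⟩
        · exact ⟨_, Or.inl ⟨e, he, rfl⟩, h⟩
        · exact ⟨_, Or.inr ⟨e, he, rfl⟩, h⟩
      · rintro ⟨v, ⟨e, he, rfl⟩ | ⟨e, he, rfl⟩, h⟩
        · exact ⟨e, he, Or.inl h⟩
        · exact ⟨e, he, Or.inr h⟩
    rw [hbU, card_biUnion, sum_union hST]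
    · have h1 : ∑ v ∈ S, #(slots v) = ∑ v ∈ S, f v := by
        refine sum_congr rfl fun v hv => ?_
        rw [hslots_card, if_pos]
        simpa [hX] using hSX v hv
      have h2 : ∑ v ∈ T, #(slots v) + ∑ v ∈ T, f v = ∑ v ∈ T, deg H v := by
        rw [← sum_add_distrib]
        refine sum_congr rfl fun v hv => ?_
        have hvY := hTY v hv
        have hv' : x v = false := by simpa [hY] using hvY
        rw [hslots_card, if_neg (by simp [hv'])]
        exact Nat.sub_add_cancel (hfle v hvY)
      have h3 : #s ≤ edgesBetween H S T := by
        have : #s = #(s.map (Function.Embedding.subtype _)) := (card_map _).symm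
        rw [this]
        unfold edgesBetween degIn
        rw [← card_sigma]
        refine card_le_card_of_injOn (fun e => ⟨e.1, e.2⟩) ?_ ?_
        · intro e he
          simp only [coe_map, Set.mem_image, mem_coe] at he
          obtain ⟨e', he', rfl⟩ := he
          simp only [coe_sigma, Set.mem_sigma_iff, mem_coe, mem_filter]
          exact ⟨mem_image_of_mem _ he', mem_image_of_mem (fun e : E => e.1.2) he',
            (mem_filter.1 e'.2).2⟩
        · intro e _ e' _ h
          simp only [Sigma.mk.injEq, heq_eq_eq] at h
          exact Prod.ext h.1 h.2
      -- Hall's condition asks for `e(S, T) ≤ f(S) + deg(T) - f(T)`. As `deg(T) = e(S, T) + e(X \ S,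
      -- T)`, this is the cut condition for the complement of `S`.
      have h4 := hcut (X \ S) T (by simp [hX]; tauto) (fun v hv => by simpa [hY] using hTY v hv)
      have hXS : X \ (X \ S) = S := by
        exact Finset.sdiff_sdiff_eq_self hSX
      rw [hXS] at h4
      have h5 : ∑ v ∈ T, deg H v = edgesBetween H S T + edgesBetween H (X \ S) T := by
        rw [edgesBetween_comm H S, edgesBetween_comm H (X \ S)]
        unfold edgesBetween
        rw [← sum_add_distrib]
        refine sum_congr rfl fun v hv => ?_
        rw [← degIn_union _ _ disjoint_sdiff, union_sdiff_of_subset hSX]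
        refine degIn_congr_inter H v fun u hu => ?_
        have := hx v u hu
        have hv' : x v = false := by simpa [hY] using hTY v hv
        simp [hX]
        simpa [hv'] using this.symm
      omega
    · intro u _ v _ huv
      rw [Function.onFun, disjoint_left]
      intro a h1 h2
      exact huv (((hslots_mem _ _).1 h1).1.symm.trans ((hslots_mem _ _).1 h2).1)
  obtain ⟨g, hginj, hg⟩ := (Finset.all_card_le_biUnion_card_iff_exists_injective _).1 hall
  let rel : V → V → Prop := fun p q => ∃ h : (p, q) ∈ E, (g ⟨(p, q), h⟩).1 = p
  have hrel : ∀ p q, rel p q → x p = true ∧ x q = false ∧ H.Adj p q := by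
    rintro p q ⟨h, _⟩
    have h1 := mem_filter.1 h
    have h2 := mem_product.1 h1.1
    simp only [hX, hY, mem_filter, mem_univ, true_and] at h2
    exact ⟨h2.1, h2.2, h1.2⟩
  let H' : SimpleGraph V :=
    { Adj := fun u v => rel u v ∨ rel v u
      symm := ⟨fun u v h => h.symm⟩
      loopless := ⟨fun u h => by
        rcases h with h | h <;> exact (hrel _ _ h).2.2.ne rfl⟩ }
  have hle : H' ≤ H := by
    rintro u v (h | h)
    · exact (hrel _ _ h).2.2
    · exact (hrel _ _ h).2.2.symm
  have hp : ∀ p ∈ X, deg H' p ≤ f p := by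
    intro p hp
    have hpx : x p = true := by simpa [hX] using hp
    have hadj : ∀ q, H'.Adj p q → rel p q := by
      rintro q (h | h)
      · exact h
      · have := (hrel _ _ h).2.1; simp [hpx] at this
    have : #(slots p) = f p := by rw [hslots_card, if_pos hpx]
    rw [← this]
    unfold deg degIn
    refine card_le_card_of_injOn
      (fun q => if h : (p, q) ∈ E then g ⟨(p, q), h⟩ else (p, 0)) ?_ ?_
    · intro q hq
      simp only [coe_filter, mem_univ, true_and, Set.mem_ofPred_eq] at hq
      obtain ⟨h, h1⟩ := hadj q hq
      simp only [dif_pos h]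
      rcases mem_union.1 (hg ⟨(p, q), h⟩) with h2 | h2
      · exact h2
      · exfalso
        have h3 := ((hslots_mem _ _).1 h2).1
        rw [h1] at h3
        exact (hle hq).ne h3
    · intro q hq q' hq' heq
      simp only [coe_filter, mem_univ, true_and, Set.mem_ofPred_eq] at hq hq'
      obtain ⟨h, _⟩ := hadj q hq
      obtain ⟨h', _⟩ := hadj q' hq'
      simp only [dif_pos h, dif_pos h'] at heq
      have := hginj heq
      simpa using this
  have hq : ∀ q ∈ Y, f q ≤ deg H' q := by
    intro q hq
    have hqx : x q = false := by simpa [hY] using hq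
    have h1 : deg (H \ H') q ≤ #(slots q) := by
      unfold deg degIn
      refine card_le_card_of_injOn
        (fun p => if h : (p, q) ∈ E then g ⟨(p, q), h⟩ else (p, 0)) ?_ ?_
      · intro p hp
        simp only [coe_filter, mem_univ, true_and, Set.mem_ofPred_eq, SimpleGraph.sdiff_adj] at hp
        have hpx : x p = true := by
          have := hx _ _ hp.1
          simpa [hqx] using this.symm
        have hE : (p, q) ∈ E := by
          simp only [E, mem_filter, mem_product, hX, hY, mem_univ, true_and]
          exact ⟨⟨hpx, hqx⟩, hp.1.symm⟩
        simp only [dif_pos hE]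
        rcases mem_union.1 (hg ⟨(p, q), hE⟩) with h2 | h2
        · exact absurd (Or.inr ⟨hE, ((hslots_mem _ _).1 h2).1⟩) hp.2
        · exact h2
      · intro p hp p' hp' heq
        simp only [coe_filter, mem_univ, true_and, Set.mem_ofPred_eq, SimpleGraph.sdiff_adj]
          at hp hp'
        have hE : ∀ p, H.Adj q p → (p, q) ∈ E := by
          intro p hp
          have hpx : x p = true := by
            have := hx _ _ hp
            simpa [hqx] using this.symm
          simp only [E, mem_filter, mem_product, hX, hY, mem_univ, true_and]
          exact ⟨⟨hpx, hqx⟩, hp.symm⟩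
        simp only [dif_pos (hE p hp.1), dif_pos (hE p' hp'.1)] at heq
        have := hginj heq
        simpa using this
    rw [hslots_card, if_neg (by simp [hqx])] at h1
    have h2 := deg_sdiff_add hle q
    have h3 := hfle q hq
    omega
  have hH'x : ∀ u v, H'.Adj u v → x u ≠ x v := fun u v h => hx u v (hle h)
  -- The slots give upper bounds on `X` and lower bounds on `Y`. Both degree sums of `H'` agree, and
  -- so do both sums of `f`, so every inequality is an equality.
  have hs := sum_deg_eq_of_crossing H' x hH'x
  rw [← hX, ← hY] at hs
  have hs1 : ∑ v ∈ X, deg H' v ≤ ∑ v ∈ X, f v := sum_le_sum hp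
  have hs2 : ∑ v ∈ Y, f v ≤ ∑ v ∈ Y, deg H' v := sum_le_sum hq
  have e1 : ∑ v ∈ X, deg H' v = ∑ v ∈ X, f v := by omega
  have e2 : ∑ v ∈ Y, f v = ∑ v ∈ Y, deg H' v := by omega
  refine ⟨H', hle, fun v => ?_⟩
  cases hv : x v
  · exact ((sum_eq_sum_iff_of_le hq).1 e2 v (by simp [hY, hv])).symm
  · exact (sum_eq_sum_iff_of_le hp).1 e1 v (by simp [hX, hv])

end Factor

end RegBip

namespace RegBip

/-! ### The Lovász local lemma by counting. -/

section LocalLemma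

variable {P C : Type*} [Fintype P] [DecidableEq P] [Fintype C]

open Classical in
/-- Events determined by complementary sets of coordinates are independent. -/
theorem card_inter_mul_card_eq (A B : (P → C) → Prop) (S : Finset P)
    (hA : ∀ ω ω' : P → C, (∀ p ∈ S, ω p = ω' p) → (A ω ↔ A ω'))
    (hB : ∀ ω ω' : P → C, (∀ p, p ∉ S → ω p = ω' p) → (B ω ↔ B ω')) :
    #{ω | A ω ∧ B ω} * Fintype.card (P → C) = #{ω | A ω} * #{ω | B ω} := by
  rw [← card_univ, ← card_product, ← card_product]
  -- Exchanging the coordinates outside `S` between two sample points is an involution on pairs, and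
  -- it matches the two products.
  let mix : (P → C) → (P → C) → P → C := fun ω ω' p => if p ∈ S then ω p else ω' p
  have hmm : ∀ ω ω', mix (mix ω ω') (mix ω' ω) = ω := by
    intro ω ω'; funext p; simp only [mix]; split_ifs <;> rfl
  have hA1 : ∀ ω ω', A (mix ω ω') ↔ A ω := fun ω ω' => hA _ _ fun p hp => by simp [mix, hp]
  have hB1 : ∀ ω ω', B (mix ω ω') ↔ B ω' := fun ω ω' => hB _ _ fun p hp => by simp [mix, hp]
  refine card_nbij' (fun z => (mix z.1 z.2, mix z.2 z.1)) (fun z => (mix z.1 z.2, mix z.2 z.1))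
    ?_ ?_ ?_ ?_
  · rintro ⟨ω, ω'⟩ h
    simpa [hA1, hB1] using h
  · rintro ⟨ω, ω'⟩ h
    simpa [hA1, hB1] using h
  · rintro ⟨ω, ω'⟩ _
    simp [hmm]
  · rintro ⟨ω, ω'⟩ _
    simp [hmm]

open Classical in
/-- The symmetric Lovász local lemma on a finite product space with the uniform measure. -/
theorem local_lemma [Nonempty C] {ι : Type*} [Fintype ι]
    (B : ι → (P → C) → Prop) (S : ι → Finset P)
    (hB : ∀ i (ω ω' : P → C), (∀ p ∈ S i, ω p = ω' p) → (B i ω ↔ B i ω'))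
    (D : ℕ) (hD : 0 < D) (hdep : ∀ i, #{j | ¬ Disjoint (S i) (S j)} ≤ D)
    (hprob : ∀ i, 4 * D * #{ω | B i ω} ≤ Fintype.card (P → C)) :
    ∃ ω : P → C, ∀ i, ¬ B i ω := by
  let N : Finset ι → ℕ := fun T => #{ω : P → C | ∀ j ∈ T, ¬ B j ω}
  let M : ι → Finset ι → ℕ := fun i T => #{ω : P → C | B i ω ∧ ∀ j ∈ T, ¬ B j ω}
  have hΩ : 0 < Fintype.card (P → C) := Fintype.card_pos
  have hins : ∀ i T, N T = N (insert i T) + M i T := by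
    intro i T
    simp only [N, M]
    rw [← card_union_of_disjoint]
    · congr 1
      ext ω
      simp only [mem_filter, mem_univ, true_and, mem_union, mem_insert, forall_eq_or_imp]
      tauto
    · rw [disjoint_filter]
      intro ω _ h1 h2
      exact h1 i (mem_insert_self _ _) h2.1
  have hunion : ∀ (T1 T2 : Finset ι), N T2 ≤ N (T1 ∪ T2) + ∑ i ∈ T1, M i T2 := by
    intro T1 T2
    simp only [N, M]
    refine le_trans ?_ (Nat.add_le_add_left card_biUnion_le _)
    refine le_trans (card_le_card ?_) (card_union_le _ _)
    intro ω hω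
    simp only [mem_filter, mem_univ, true_and, mem_union, mem_biUnion] at hω ⊢
    by_cases h : ∀ i ∈ T1, ¬ B i ω
    · left
      rintro j (hj | hj)
      · exact h j hj
      · exact hω j hj
    · push Not at h
      obtain ⟨i, hi, hBi⟩ := h
      exact Or.inr ⟨i, hi, hBi, hω⟩
  -- Conditioned on avoiding `T`, the event `B i` has probability at most `1 / (2D)`. Dropping the
  -- events of `T` that depend on `B i` makes it independent of the rest. By induction and a union
  -- bound over at most `D` events, this loses only a factor 2.
  have key : ∀ (k : ℕ) (T : Finset ι), #T ≤ k → ∀ i, 2 * D * M i T ≤ N T := by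
    intro k
    induction k using Nat.strong_induction_on with
    | _ k ih =>
      intro T hT i
      let T1 := T.filter fun j => ¬ Disjoint (S i) (S j)
      let T2 := T.filter fun j => Disjoint (S i) (S j)
      have hT12 : T1 ∪ T2 = T := by
        rw [union_comm]; exact filter_union_filter_not_eq _ _
      have hM2 : M i T ≤ M i T2 := by
        refine card_le_card fun ω hω => ?_
        simp only [mem_filter, mem_univ, true_and] at hω ⊢
        exact ⟨hω.1, fun j hj => hω.2 j (mem_filter.1 hj).1⟩
      have hind : M i T2 * Fintype.card (P → C) = #{ω | B i ω} * N T2 := by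
        have h := card_inter_mul_card_eq (B i) (fun ω => ∀ j ∈ T2, ¬ B j ω) (S i) (hB i) ?_
        · simp only [M, N]
          convert h
        intro ω ω' h
        refine forall_congr' fun j => imp_congr_right fun hj => not_congr (hB j _ _ fun p hp => ?_)
        exact h p fun hp' => disjoint_left.1 (mem_filter.1 hj).2 hp' hp
      have h4 : 4 * D * M i T2 ≤ N T2 := by
        refine Nat.le_of_mul_le_mul_right ?_ hΩ
        calc 4 * D * M i T2 * Fintype.card (P → C) = 4 * D * #{ω | B i ω} * N T2 := by
              rw [mul_assoc, hind, mul_assoc (4 * D)]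
          _ ≤ Fintype.card (P → C) * N T2 := Nat.mul_le_mul_right _ (hprob i)
          _ = _ := mul_comm _ _
      have h1card : #T1 ≤ D :=
        (card_le_card (filter_subset_filter _ (subset_univ T))).trans (hdep i)
      have hhalf : N T2 ≤ 2 * N T := by
        rcases T1.eq_empty_or_nonempty with h0 | hne
        · rw [h0, empty_union] at hT12
          rw [hT12]; omega
        · have hlt : #T2 < k := by
            have : #T1 + #T2 = #T := by
              rw [add_comm]; exact card_filter_add_card_filter_not _
            have := hne.card_pos
            omega
          have hu := hunion T1 T2
          rw [hT12] at hu
          have hs : 2 * D * ∑ j ∈ T1, M j T2 ≤ D * N T2 := by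
            rw [mul_sum]
            calc ∑ j ∈ T1, 2 * D * M j T2 ≤ ∑ j ∈ T1, N T2 :=
                  sum_le_sum fun j _ => ih _ hlt T2 le_rfl j
              _ = #T1 * N T2 := by rw [sum_const, smul_eq_mul]
              _ ≤ _ := Nat.mul_le_mul_right _ h1card
          have hs' : 2 * ∑ j ∈ T1, M j T2 ≤ N T2 := by
            refine Nat.le_of_mul_le_mul_left ?_ hD
            calc D * (2 * ∑ j ∈ T1, M j T2) = 2 * D * ∑ j ∈ T1, M j T2 := by ring
              _ ≤ _ := hs
          omega
      have h5 : 4 * D * M i T ≤ 2 * N T :=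
        (Nat.mul_le_mul_left _ hM2).trans (h4.trans hhalf)
      have : 4 * D * M i T = 2 * (2 * D * M i T) := by ring
      omega
  have hpos : ∀ T : Finset ι, 0 < N T := by
    intro T
    induction T using Finset.induction_on with
    | empty => simpa [N] using hΩ
    | insert i T _ ih =>
      have h1 := hins i T
      have h2 := key _ T le_rfl i
      have h3 : 2 * M i T ≤ 2 * D * M i T := Nat.mul_le_mul_right _ (by omega)
      omega
  obtain ⟨ω, hω⟩ := card_pos.1 (hpos univ)
  exact ⟨ω, fun i => by simpa using (mem_filter.1 hω).2 i⟩

end LocalLemma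

end RegBip

namespace RegBip

/-! ### Chernoff bound and mean values. -/

section Concentration

variable {P C : Type*} [Fintype P] [DecidableEq P] [Fintype C]

open Classical in
/-- A Chernoff bound for sums of independent centred variables on a uniform product space. -/
theorem card_lt_sum_le [Nonempty C] (Z : P → C → ℝ) (Q : Finset P)
    (hQ : ∀ p, p ∉ Q → ∀ c, Z p c = 0) (hZ : ∀ p c, |Z p c| ≤ 2) (hmean : ∀ p, ∑ c, Z p c = 0)
    (d : ℕ) (hQd : #Q ≤ d) {ε : ℝ} (hε0 : 0 ≤ ε) (hε1 : ε ≤ 1) :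
    (#{ω : P → C | ε * d < ∑ p, Z p (ω p)} : ℝ) ≤
      Fintype.card (P → C) * Real.exp (-(ε ^ 2 * d / 16)) := by
  -- With parameter `ε / 8` the exponent is at most `ε / 4` in absolute value, so `exp y ≤ 1 + y +
  -- y²` applies. The final exponent is `ε²d/16 - ε²d/8`.
  have hterm : ∀ p c, Real.exp (ε / 8 * Z p c) ≤
      1 + ε / 8 * Z p c + if p ∈ Q then ε ^ 2 / 16 else 0 := by
    intro p c
    by_cases hp : p ∈ Q
    · rw [if_pos hp]
      have h1 : |ε / 8 * Z p c| ≤ ε / 4 := by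
        rw [abs_mul, abs_of_nonneg (by positivity)]
        have := mul_le_mul_of_nonneg_left (hZ p c) (by positivity : 0 ≤ ε / 8)
        linarith
      have h2 := Real.abs_exp_sub_one_sub_id_le (h1.trans (by linarith))
      have h3 : (ε / 8 * Z p c) ^ 2 ≤ (ε / 4) ^ 2 := sq_le_sq' (by linarith [(abs_le.1 h1).1])
        (abs_le.1 h1).2
      have := (abs_le.1 h2).2
      linarith [(by ring : (ε / 4) ^ 2 = ε ^ 2 / 16)]
    · rw [if_neg hp, hQ p hp c]
      simp
  have hfac : ∀ p, ∑ c, Real.exp (ε / 8 * Z p c) ≤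
      Fintype.card C * if p ∈ Q then Real.exp (ε ^ 2 / 16) else 1 := by
    intro p
    refine (sum_le_sum fun c _ => hterm p c).trans ?_
    rw [sum_add_distrib, sum_add_distrib, ← mul_sum, hmean p, sum_const, sum_const, card_univ,
      nsmul_eq_mul, nsmul_eq_mul, mul_zero, add_zero, mul_one, ← mul_one_add]
    refine mul_le_mul_of_nonneg_left ?_ (Nat.cast_nonneg _)
    split_ifs
    · have := Real.add_one_le_exp (ε ^ 2 / 16)
      linarith
    · simp
  have hmgf : ∑ ω : P → C, Real.exp (ε / 8 * ∑ p, Z p (ω p)) ≤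
      Fintype.card (P → C) * Real.exp (ε ^ 2 / 16 * d) := by
    have h1 : ∑ ω : P → C, Real.exp (ε / 8 * ∑ p, Z p (ω p)) =
        ∏ p, ∑ c, Real.exp (ε / 8 * Z p c) := by
      rw [Finset.prod_univ_sum, Fintype.piFinset_univ]
      refine sum_congr rfl fun ω _ => ?_
      rw [mul_sum, Real.exp_sum]
    rw [h1]
    refine (prod_le_prod (fun p _ => sum_nonneg fun c _ => (Real.exp_pos _).le)
      fun p _ => hfac p).trans ?_
    rw [prod_mul_distrib, prod_const, card_univ, prod_ite_mem, univ_inter, prod_const,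
      ← Real.exp_nat_mul, Fintype.card_fun]
    push_cast
    refine mul_le_mul_of_nonneg_left ?_ (by positivity)
    rw [Real.exp_le_exp, mul_comm]
    have : (#Q : ℝ) ≤ d := by exact_mod_cast hQd
    gcongr
  have hmarkov : (#{ω : P → C | ε * d < ∑ p, Z p (ω p)} : ℝ) * Real.exp (ε / 8 * (ε * d)) ≤
      ∑ ω : P → C, Real.exp (ε / 8 * ∑ p, Z p (ω p)) := by
    rw [← nsmul_eq_mul, ← sum_const]
    refine (sum_le_sum (g := fun ω => Real.exp (ε / 8 * ∑ p, Z p (ω p))) ?_).trans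
      (sum_le_sum_of_subset_of_nonneg (filter_subset _ _) fun ω _ _ => (Real.exp_pos _).le)
    intro ω hω
    rw [Real.exp_le_exp]
    exact mul_le_mul_of_nonneg_left (mem_filter.1 hω).2.le (by positivity)
  have h := hmarkov.trans hmgf
  rw [← le_div_iff₀ (Real.exp_pos _), mul_div_assoc, ← Real.exp_sub] at h
  refine h.trans (le_of_eq ?_)
  congr 2
  ring

/-- Only the bits outside `S` remain free. This is the mean value subtracted in `exists_even_split`.
-/
theorem card_agree_on {s : ℕ} (S : Finset (Fin s)) (a : Fin s → Bool) :
    (#{c : Fin s → Bool | ∀ i ∈ S, c i = a i} : ℝ) = 2 ^ s / 2 ^ #S := by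
  have h1 : (univ.filter fun c : Fin s → Bool => ∀ i ∈ S, c i = a i) =
      Fintype.piFinset fun i => if i ∈ S then {a i} else univ := by
    ext c
    simp only [mem_filter, mem_univ, true_and, Fintype.mem_piFinset]
    refine forall_congr' fun i => ?_
    split_ifs with h <;> simp [h]
  have h2 : #S + #(univ \ S) = s := by
    rw [add_comm, card_sdiff_add_card_eq_card (subset_univ S), card_univ, Fintype.card_fin]
  have h3 : ∀ i, #(if i ∈ S then {a i} else (univ : Finset Bool)) =
      if i ∈ univ \ S then 2 else 1 := by
    intro i
    by_cases hi : i ∈ S <;> simp [hi]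
  rw [h1, Fintype.card_piFinset, prod_congr rfl fun i _ => h3 i, prod_ite_mem, univ_inter,
    prod_const, eq_div_iff (by positivity)]
  push_cast
  rw [← pow_add, add_comm, h2]

end Concentration

/-! ### Random bits on pairs, via the local lemma. -/

section Split

variable {V P I : Type*} [Fintype V] [DecidableEq V] [Fintype P] [DecidableEq P] [Fintype I]

/-- Random bits attached to pairs of vertices split all neighbourhoods evenly. -/
theorem exists_even_split (pr : V → P) (hpr : ∀ p, #{v | pr v = p} ≤ 2) {s : ℕ}
    (G : SimpleGraph V) {d : ℕ} (hd0 : 0 < d) (hd : ∀ v, deg G v = d)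
    (S : I → Finset (Fin s)) (a : I → V → Fin s → Bool) {ε : ℝ} (hε0 : 0 ≤ ε) (hε1 : ε ≤ 1)
    (hsize : 16 * (d : ℝ) ^ 2 * Fintype.card I * Real.exp (-(ε ^ 2 * d / 16)) ≤ 1) :
    ∃ ω : P → Fin s → Bool, ∀ v τ,
      |(degIn G v {u | ∀ i ∈ S τ, ω (pr u) i = a τ u i} : ℝ) - d / 2 ^ #(S τ)| ≤ ε * d := by
  classical
  let N : V → Finset V := fun v => univ.filter fun u => G.Adj v u
  have hN : ∀ v, #(N v) = d := hd
  let Z : V → I → P → (Fin s → Bool) → ℝ := fun v τ p c =>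
    ∑ u ∈ N v with pr u = p, ((if ∀ i ∈ S τ, c i = a τ u i then (1 : ℝ) else 0) - 1 / 2 ^ #(S τ))
  have hZsum : ∀ v τ (ω : P → Fin s → Bool), ∑ p, Z v τ p (ω p) =
      (degIn G v {u | ∀ i ∈ S τ, ω (pr u) i = a τ u i} : ℝ) - d / 2 ^ #(S τ) := by
    intro v τ ω
    have h1 : ∑ p, Z v τ p (ω p) = ∑ u ∈ N v,
        ((if ∀ i ∈ S τ, ω (pr u) i = a τ u i then (1 : ℝ) else 0) - 1 / 2 ^ #(S τ)) := by
      rw [← sum_fiberwise (N v) pr]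
      refine sum_congr rfl fun p _ => sum_congr rfl fun u hu => ?_
      rw [(mem_filter.1 hu).2]
    rw [h1, sum_sub_distrib, sum_const, hN, nsmul_eq_mul, mul_one_div]
    congr 1
    rw [← sum_filter, sum_const, nsmul_eq_mul, mul_one]
    unfold degIn
    congr 2
    ext u
    simp only [N, mem_filter, mem_univ, true_and]
    tauto
  have hZ0 : ∀ v τ p, p ∉ (N v).image pr → ∀ c, Z v τ p c = 0 := by
    intro v τ p hp c
    refine sum_eq_zero fun u hu => ?_
    exact absurd (mem_image.2 ⟨u, (mem_filter.1 hu).1, (mem_filter.1 hu).2⟩) hp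
  have hZ2 : ∀ v τ p c, |Z v τ p c| ≤ 2 := by
    intro v τ p c
    refine (abs_sum_le_sum_abs _ _).trans ?_
    have hone : ∀ u, |(if ∀ i ∈ S τ, c i = a τ u i then (1 : ℝ) else 0) - 1 / 2 ^ #(S τ)| ≤ 1 := by
      intro u
      have h1 : (0 : ℝ) ≤ 1 / 2 ^ #(S τ) := by positivity
      have h2 : (1 : ℝ) / 2 ^ #(S τ) ≤ 1 := by
        rw [div_le_one (by positivity)]
        exact one_le_pow₀ (by norm_num)
      rw [abs_le]
      split_ifs <;> constructor <;> linarith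
    refine (sum_le_sum fun u _ => hone u).trans ?_
    rw [sum_const, nsmul_eq_mul, mul_one]
    have : #((N v).filter fun u => pr u = p) ≤ 2 :=
      (card_le_card (filter_subset_filter _ (subset_univ _))).trans (hpr p)
    exact_mod_cast this
  have hZm : ∀ v τ p, ∑ c, Z v τ p c = 0 := by
    intro v τ p
    simp only [Z]
    rw [sum_comm]
    refine sum_eq_zero fun u _ => ?_
    rw [sum_sub_distrib, ← sum_filter, sum_const, sum_const, card_univ, nsmul_eq_mul, mul_one,
      nsmul_eq_mul, Fintype.card_fun, Fintype.card_bool, Fintype.card_fin]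
    have := card_agree_on (S τ) (a τ u)
    rw [this]
    push_cast
    ring
  let B : V → (P → Fin s → Bool) → Prop := fun v ω => ∃ τ,
    ε * d < ∑ p, Z v τ p (ω p) ∨ ε * d < ∑ p, -Z v τ p (ω p)
  have hBdet : ∀ v (ω ω' : P → Fin s → Bool), (∀ p ∈ (N v).image pr, ω p = ω' p) →
      (B v ω ↔ B v ω') := by
    intro v ω ω' h
    have : ∀ τ p, Z v τ p (ω p) = Z v τ p (ω' p) := by
      intro τ p
      by_cases hp : p ∈ (N v).image pr
      · rw [h p hp]
      · rw [hZ0 v τ p hp, hZ0 v τ p hp]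
    simp only [B, this]
  -- A dependent vertex is reached from `v` by going to one of `d` neighbours, then to one of at
  -- most two members of its pair, then to one of `d` neighbours.
  have hdep : ∀ v, #{v' | ¬ Disjoint ((N v).image pr) ((N v').image pr)} ≤ 2 * d ^ 2 := by
    intro v
    have hsub : (univ.filter fun v' => ¬ Disjoint ((N v).image pr) ((N v').image pr)) ⊆
        (N v).biUnion fun u => (univ.filter fun w => pr w = pr u).biUnion N := by
      intro v' hv'
      have h1 := (mem_filter.1 hv').2
      rw [not_disjoint_iff] at h1
      obtain ⟨p, hp, hp'⟩ := h1
      obtain ⟨u, hu, rfl⟩ := mem_image.1 hp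
      obtain ⟨w, hw, hwp⟩ := mem_image.1 hp'
      simp only [mem_biUnion, mem_filter, mem_univ, true_and]
      refine ⟨u, hu, w, hwp, ?_⟩
      simp only [N, mem_filter, mem_univ, true_and] at hw ⊢
      exact hw.symm
    refine (card_le_card hsub).trans ?_
    have h2 : ∀ u ∈ N v, #((univ.filter fun w => pr w = pr u).biUnion N) ≤ 2 * d := by
      intro u _
      refine (card_biUnion_le_card_mul _ _ d fun w _ => (hN w).le).trans ?_
      exact Nat.mul_le_mul_right _ (hpr _)
    refine (card_biUnion_le_card_mul _ _ _ h2).trans ?_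
    rw [hN]
    exact le_of_eq (by ring)
  have himg : ∀ v, #((N v).image pr) ≤ d := fun v => card_image_le.trans (hN v).le
  have hprob : ∀ v, 4 * (2 * d ^ 2) * #{ω | B v ω} ≤ Fintype.card (P → Fin s → Bool) := by
    intro v
    set Ω := Fintype.card (P → Fin s → Bool) with hΩ
    have h1 : (#{ω | B v ω} : ℝ) ≤
        Fintype.card I * (2 * (Ω * Real.exp (-(ε ^ 2 * d / 16)))) := by
      have hsub : (univ.filter fun ω => B v ω) ⊆ (univ : Finset I).biUnion fun τ =>
          (univ.filter fun ω : P → Fin s → Bool => ε * d < ∑ p, Z v τ p (ω p)) ∪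
          (univ.filter fun ω : P → Fin s → Bool => ε * d < ∑ p, -Z v τ p (ω p)) := by
        intro ω hω
        obtain ⟨τ, h⟩ := (mem_filter.1 hω).2
        simp only [mem_biUnion, mem_univ, true_and, mem_union, mem_filter]
        exact ⟨τ, h⟩
      have h2 : (#{ω | B v ω} : ℝ) ≤ ∑ τ : I,
          ((#{ω : P → Fin s → Bool | ε * d < ∑ p, Z v τ p (ω p)} : ℝ) +
            #{ω : P → Fin s → Bool | ε * d < ∑ p, -Z v τ p (ω p)}) := by
        have := (card_le_card hsub).trans (card_biUnion_le.trans
          (sum_le_sum fun τ _ => card_union_le _ _))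
        exact_mod_cast this
      refine h2.trans ?_
      have h3 : ∀ τ : I, ((#{ω : P → Fin s → Bool | ε * d < ∑ p, Z v τ p (ω p)} : ℝ) +
            #{ω : P → Fin s → Bool | ε * d < ∑ p, -Z v τ p (ω p)}) ≤
          2 * (Ω * Real.exp (-(ε ^ 2 * d / 16))) := by
        intro τ
        have e1 := card_lt_sum_le (Z v τ) ((N v).image pr) (hZ0 v τ) (hZ2 v τ) (hZm v τ) d
          (himg v) hε0 hε1
        have e2 := card_lt_sum_le (fun p c => -Z v τ p c) ((N v).image pr)
          (fun p hp c => by rw [hZ0 v τ p hp, neg_zero])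
          (fun p c => by rw [abs_neg]; exact hZ2 v τ p c)
          (fun p => by rw [sum_neg_distrib, hZm v τ, neg_zero]) d (himg v) hε0 hε1
        linarith
      refine (sum_le_sum fun τ _ => h3 τ).trans ?_
      rw [sum_const, card_univ, nsmul_eq_mul]
    have h2 : (4 * (2 * (d : ℝ) ^ 2) * #{ω | B v ω} : ℝ) ≤ Ω := by
      calc (4 * (2 * (d : ℝ) ^ 2) * #{ω | B v ω} : ℝ)
          ≤ 4 * (2 * (d : ℝ) ^ 2) *
            (Fintype.card I * (2 * (Ω * Real.exp (-(ε ^ 2 * d / 16))))) := by gcongr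
        _ = (16 * (d : ℝ) ^ 2 * Fintype.card I * Real.exp (-(ε ^ 2 * d / 16))) * Ω := by ring
        _ ≤ 1 * Ω := by gcongr
        _ = Ω := one_mul _
    exact_mod_cast h2
  obtain ⟨ω, hω⟩ := local_lemma B (fun v => (N v).image pr) hBdet (2 * d ^ 2) (by positivity)
    (fun v => by convert hdep v) (fun v => by convert hprob v)
  refine ⟨ω, fun v τ => ?_⟩
  have h := hω v
  simp only [B, not_exists, not_or, not_lt, sum_neg_distrib] at h
  have h1 := h τ
  rw [← hZsum, abs_le]
  constructor <;> linarith [h1.1, h1.2]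

end Split

end RegBip

namespace RegBip

/-! ### Locally maximal cuts and their iteration. -/

section Halving

variable {P : Type*} [Fintype P]

/-- A locally maximal cut leaves at most half of the weight at each point uncut. -/
theorem exists_halving_cut (w : P → P → ℕ) (hw : ∀ p q, w p q = w q p) (hw0 : ∀ p, w p p = 0) :
    ∃ j : P → Bool, ∀ p, 2 * ∑ q with j q = j p, w p q ≤ ∑ q, w p q := by
  classical
  let cut : (P → Bool) → ℕ := fun j => ∑ p, ∑ q, if j q = j p then w p q else 0
  obtain ⟨j, -, hj⟩ := exists_min_image (univ : Finset (P → Bool)) cut univ_nonempty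
  refine ⟨j, fun p => ?_⟩
  by_contra hlt
  push Not at hlt
  have hsplit : ∑ q with j q = j p, w p q + ∑ q with j q ≠ j p, w p q = ∑ q, w p q :=
    sum_filter_add_sum_filter_not _ _ _
  -- Flipping `p` exchanges its cut and uncut weight and changes nothing else, so minimality of the
  -- total uncut weight gives the bound.
  let j' : P → Bool := Function.update j p (!j p)
  have hj'p : j' p = !j p := Function.update_self ..
  have hj'q : ∀ q, q ≠ p → j' q = j q := fun q hq => Function.update_of_ne hq _ _
  have hrow : ∀ (i : P → Bool), cut i = (∑ a ∈ univ.erase p, ∑ b ∈ univ.erase p,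
      if i b = i a then w a b else 0) + 2 * ∑ q, if i q = i p then w p q else 0 := by
    intro i
    have h1 : ∀ a, ∑ b, (if i b = i a then w a b else 0) =
        (∑ b ∈ univ.erase p, if i b = i a then w a b else 0) + if i p = i a then w a p else 0 :=
      fun a => (sum_erase_add _ _ (mem_univ p)).symm
    have h2 : ∑ q, (if i q = i p then w p q else 0) =
        ∑ q ∈ univ.erase p, if i q = i p then w p q else 0 := by
      rw [← sum_erase_add _ _ (mem_univ p)]; simp [hw0]
    simp only [cut]
    rw [← sum_erase_add _ _ (mem_univ p), h2, sum_congr rfl fun a _ => h1 a, sum_add_distrib]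
    have h3 : (∑ a ∈ univ.erase p, if i p = i a then w a p else 0) =
        ∑ q ∈ univ.erase p, if i q = i p then w p q else 0 := by
      refine sum_congr rfl fun a _ => ?_
      rw [hw a p]
      simp only [eq_comm]
    rw [h3]
    ring
  have hA : (∑ a ∈ univ.erase p, ∑ b ∈ univ.erase p, if j' b = j' a then w a b else 0) =
      ∑ a ∈ univ.erase p, ∑ b ∈ univ.erase p, if j b = j a then w a b else 0 := by
    refine sum_congr rfl fun a ha => sum_congr rfl fun b hb => ?_
    rw [hj'q a (ne_of_mem_erase ha), hj'q b (ne_of_mem_erase hb)]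
  have hB : (∑ q, if j' q = j' p then w p q else 0) = ∑ q with j q ≠ j p, w p q := by
    rw [sum_filter]
    refine sum_congr rfl fun q _ => ?_
    by_cases hq : q = p
    · subst hq; simp [hw0]
    · rw [hj'q q hq, hj'p]
      cases j q <;> cases j p <;> simp
  have hmin := hj j' (mem_univ _)
  rw [hrow j, hrow j', hA, hB, ← sum_filter] at hmin
  omega

/-- Iterated halving cuts: after `k` of them the uncut weight at each point has decreased
by a factor `2 ^ k`. -/
theorem exists_iterated_halving (w : P → P → ℕ) (hw : ∀ p q, w p q = w q p)
    (hw0 : ∀ p, w p p = 0) :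
    ∃ j : ℕ → P → Bool, ∀ k p, 2 ^ k * ∑ q with ∀ i < k, j i q = j i p, w p q ≤ ∑ q, w p q := by
  classical
  have hstep : ∀ k (j : ℕ → P → Bool), ∃ c : P → Bool, ∀ p,
      2 * ∑ q with (∀ i < k, j i q = j i p) ∧ c q = c p, w p q ≤
        ∑ q with ∀ i < k, j i q = j i p, w p q := by
    intro k j
    -- The next cut is taken for the weight that no earlier cut separates.
    obtain ⟨c, hc⟩ := exists_halving_cut
      (fun p q => if ∀ i < k, j i q = j i p then w p q else 0)
      (fun p q => by simp only [hw p q, eq_comm]) (fun p => by simp [hw0])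
    refine ⟨c, fun p => ?_⟩
    have := hc p
    rw [← sum_filter, ← sum_filter, filter_filter] at this
    refine le_trans (le_of_eq ?_) this
    congr 2
    ext q
    simp only [mem_filter, mem_univ, true_and]
    tauto
  choose c hc using hstep
  -- Stage `k + 1` changes only the entry with index `k`, so entry `i` is final from stage `i + 1`
  -- on, and the diagonal `F (i + 1) i` is the sequence sought.
  obtain ⟨F, hF⟩ : ∃ F : ℕ → ℕ → P → Bool,
      ∀ k, F (k + 1) = fun i => if i = k then c k (F k) else F k i :=
    ⟨fun k => Nat.rec (fun _ _ => false) (fun k j i => if i = k then c k j else j i) k,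
      fun k => rfl⟩
  have hstab : ∀ k i, i < k → F k i = F (i + 1) i := by
    intro k
    induction k with
    | zero => intro i hi; omega
    | succ k ih =>
      intro i hi
      rcases Nat.lt_succ_iff_lt_or_eq.1 hi with h | rfl
      · rw [← ih i h, hF]
        simp [h.ne]
      · rfl
  refine ⟨fun i => F (i + 1) i, fun k p => ?_⟩
  have hFk : ∀ (k : ℕ) (p : P), 2 ^ k * ∑ q : P with (∀ i < k, F k i q = F k i p), w p q ≤ ∑ q, w p q := by
    intro k p
    induction k with
    | zero => simp
    | succ k ih =>
      refine le_trans ?_ ih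
      rw [pow_succ, mul_assoc]
      refine Nat.mul_le_mul_left _ (le_trans (le_of_eq ?_) (hc k (F k) p))
      congr 2
      ext q
      simp only [mem_filter, mem_univ, true_and, hF]
      constructor
      · intro h
        refine ⟨fun i hi => ?_, ?_⟩
        · have := h i (by omega)
          simpa [hi.ne] using this
        · simpa using h k (by omega)
      · rintro ⟨h1, h2⟩ i hi
        by_cases hik : i = k
        · simpa [hik] using h2
        · simpa [hik] using h1 i (by omega)
  refine le_trans (le_of_eq ?_) (hFk k p)
  congr 2
  ext q
  simp only [mem_filter, mem_univ, true_and]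
  refine forall_congr' fun i => forall_congr' fun hi => ?_
  rw [hstab k i hi]

end Halving

end RegBip

namespace RegBip

/-! ### Greedy subgraphs of small maximum degree. -/

section Greedy

variable {V : Type*} [Fintype V]

theorem deg_edge [DecidableEq V] {a b : V} (hab : a ≠ b) (v : V) :
    deg (SimpleGraph.edge a b) v = (if v = a then 1 else 0) + if v = b then 1 else 0 := by
  classical
  unfold deg degIn
  by_cases ha : v = a
  · subst ha
    rw [if_pos rfl, if_neg hab, add_zero, card_eq_one]
    refine ⟨b, ?_⟩
    ext u
    simp only [SimpleGraph.edge_adj, mem_filter, mem_univ, true_and, mem_singleton]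
    constructor
    · rintro ⟨h | h, _⟩
      · exact h
      · exact absurd h.1 hab
    · rintro rfl; exact ⟨Or.inl rfl, hab⟩
  · by_cases hb : v = b
    · subst hb
      rw [if_neg ha, if_pos rfl, zero_add, card_eq_one]
      refine ⟨a, ?_⟩
      ext u
      simp only [SimpleGraph.edge_adj, mem_filter, mem_univ, true_and, mem_singleton]
      constructor
      · rintro ⟨h | h, _⟩
        · exact absurd h.1 ha
        · exact h
      · rintro rfl; exact ⟨Or.inr rfl, ha⟩
    · rw [if_neg ha, if_neg hb, add_zero, card_eq_zero]
      ext u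
      simp [SimpleGraph.edge_adj, ha, hb]

/-- Every edge at a vertex outside `S` ends in `S`, so the degree sum outside is at most the one
inside. -/
theorem sum_deg_le_of_cover [DecidableEq V] (Q : SimpleGraph V) (S : Finset V)
    (h : ∀ u v, Q.Adj u v → u ∈ S ∨ v ∈ S) : ∑ v, deg Q v ≤ 2 * ∑ v ∈ S, deg Q v := by
  rw [← sum_add_sum_compl S, two_mul]
  refine Nat.add_le_add_left ?_ _
  calc ∑ v ∈ Sᶜ, deg Q v = ∑ v ∈ Sᶜ, degIn Q v S := by
        refine sum_congr rfl fun v hv => degIn_congr_inter Q v fun u hu => ?_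
        have := h v u hu
        simp only [mem_compl] at hv
        simp; tauto
    _ = edgesBetween Q S Sᶜ := edgesBetween_comm Q _ _
    _ ≤ _ := sum_le_sum fun v _ => degIn_le_deg Q v _

/-- A graph with many edges has subgraphs of small maximum degree with a given number of edges. -/
theorem exists_subgraph_sum_deg_eq (Q : SimpleGraph V) (D m κ : ℕ)
    (hD : ∀ v, deg Q v ≤ D) (hm : 0 < m → 2 * m * κ + 4 * m * D < κ * ∑ v, deg Q v) :
    ∃ T ≤ Q, (∀ v, deg T v ≤ κ) ∧ ∑ v, deg T v = 2 * m := by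
  classical
  suffices h : ∀ t ≤ m, ∃ T ≤ Q, (∀ v, deg T v ≤ κ) ∧ ∑ v, deg T v = 2 * t from h m le_rfl
  intro t
  induction t with
  | zero => exact fun _ => ⟨⊥, bot_le, by simp, by simp⟩
  | succ t ih =>
    intro ht
    obtain ⟨T, hTQ, hTκ, hTs⟩ := ih (by omega)
    have hfree : ∃ a b, (Q \ T).Adj a b ∧ deg T a < κ ∧ deg T b < κ := by
      by_contra hno
      push Not at hno
      -- If no edge can be added, the saturated vertices cover the remaining edges. As `κ * #S ≤
      -- 2t`, they are too few to do so with degrees at most `D`.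
      let S : Finset V := univ.filter fun v => κ ≤ deg T v
      have hcov := sum_deg_le_of_cover (Q \ T) S (by
        intro u v huv
        by_cases hu : deg T u < κ
        · right; simpa [S] using hno u v huv hu
        · left; simpa [S] using hu)
      have h1 : ∑ v, deg Q v = ∑ v, deg (Q \ T) v + 2 * t := by
        rw [← hTs, ← sum_add_distrib]
        exact sum_congr rfl fun v _ => (deg_sdiff_add hTQ v).symm
      have h2 : ∑ v ∈ S, deg (Q \ T) v ≤ #S * D := by
        rw [← smul_eq_mul, ← sum_const]
        exact sum_le_sum fun v _ => (deg_mono sdiff_le v).trans (hD v)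
      have h3 : κ * #S ≤ 2 * t := by
        rw [← hTs, mul_comm, ← smul_eq_mul, ← sum_const]
        exact (sum_le_sum fun v hv => (mem_filter.1 hv).2).trans
          (sum_le_sum_of_subset (subset_univ S))
      have h4 := hm (by omega)
      have h5 : κ * ∑ v, deg Q v ≤ κ * (2 * t) + 2 * (2 * t) * D := by
        calc κ * ∑ v, deg Q v ≤ κ * (2 * (#S * D) + 2 * t) := Nat.mul_le_mul_left _ (by omega)
          _ = κ * (2 * t) + 2 * (κ * #S) * D := by ring
          _ ≤ _ := by gcongr
      have h6 : 2 * t * κ ≤ 2 * m * κ := by gcongr; omega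
      have h7 : 4 * t * D ≤ 4 * m * D := by gcongr; omega
      have h8 : κ * (2 * t) + 2 * (2 * t) * D = 2 * t * κ + 4 * t * D := by ring
      omega
    obtain ⟨a, b, hab, ha, hb⟩ := hfree
    have hne : a ≠ b := hab.ne
    rw [SimpleGraph.sdiff_adj] at hab
    have hdis : Disjoint T (SimpleGraph.edge a b) := by
      rw [disjoint_iff_inf_le]
      intro u v huv
      rw [SimpleGraph.inf_adj, SimpleGraph.edge_adj] at huv
      obtain ⟨h1, ⟨rfl, rfl⟩ | ⟨rfl, rfl⟩, _⟩ := huv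
      · exact hab.2 h1
      · exact hab.2 h1.symm
    refine ⟨T ⊔ SimpleGraph.edge a b, sup_le hTQ ?_, fun v => ?_, ?_⟩
    · intro u v huv
      rw [SimpleGraph.edge_adj] at huv
      obtain ⟨⟨rfl, rfl⟩ | ⟨rfl, rfl⟩, _⟩ := huv
      · exact hab.1
      · exact hab.1.symm
    · rw [deg_sup hdis, deg_edge hne]
      have := hTκ v
      split_ifs with h1 h2 h2
      · exact absurd (h1.symm.trans h2) hne
      · subst h1; omega
      · subst h2; omega
      · omega
    · simp only [deg_sup hdis, deg_edge hne, sum_add_distrib, hTs]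
      simp
      ring

end Greedy

/-! ### Edge-disjoint families chosen one by one. -/

section Families

variable {V : Type*} [Fintype V]

theorem finset_sup_adj {V : Type*} (H : ℕ → SimpleGraph V) (s : Finset ℕ) (u v : V) :
    (s.sup H).Adj u v ↔ ∃ i ∈ s, (H i).Adj u v := by
  classical
  induction s using Finset.induction_on with
  | empty => simp
  | insert i s _ ih => simp [sup_insert, ih]

theorem deg_finset_sup_le (T : ℕ → SimpleGraph V) (s : Finset ℕ) (v : V) :
    deg (s.sup T) v ≤ ∑ i ∈ s, deg (T i) v := by
  classical
  induction s using Finset.induction_on with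
  | empty => simp
  | insert i s hi ih =>
    rw [sup_insert, sum_insert hi]
    have h := deg_sdiff_add (le_sup_right : s.sup T ≤ T i ⊔ s.sup T) v
    rw [sup_sdiff_right_self] at h
    have := deg_mono (sdiff_le : T i \ s.sup T ≤ T i) v
    omega

theorem deg_finset_sup (T : ℕ → SimpleGraph V) (s : Finset ℕ)
    (hT : ∀ i ∈ s, ∀ j ∈ s, i ≠ j → Disjoint (T i) (T j)) (v : V) :
    deg (s.sup T) v = ∑ i ∈ s, deg (T i) v := by
  classical
  induction s using Finset.induction_on with
  | empty => simp
  | insert i s hi ih =>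
    rw [sup_insert, sum_insert hi, deg_sup, ih]
    · exact fun a ha b hb => hT a (mem_insert_of_mem ha) b (mem_insert_of_mem hb)
    · rw [Finset.disjoint_sup_right]
      intro j hj
      exact hT i (mem_insert_self _ _) j (mem_insert_of_mem hj) fun h => hi (h ▸ hj)

/-- Graphs of bounded degree that can be chosen avoiding any graph of small maximum degree
can be chosen to be pairwise edge-disjoint. -/
theorem exists_disjoint_family (k : ℕ) (κ : ℕ → ℕ) (Pr : ℕ → SimpleGraph V → Prop)
    (hstep : ∀ l < k, ∀ U : SimpleGraph V, (∀ v, deg U v ≤ ∑ i ∈ range l, κ i) →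
      ∃ T, Disjoint T U ∧ Pr l T ∧ ∀ v, deg T v ≤ κ l) :
    ∃ T : ℕ → SimpleGraph V, (∀ l < k, Pr l (T l)) ∧ (∀ l < k, ∀ v, deg (T l) v ≤ κ l) ∧
      ∀ i < k, ∀ j < k, i ≠ j → Disjoint (T i) (T j) := by
  induction k with
  | zero => exact ⟨fun _ => ⊥, by simp, by simp, by simp⟩
  | succ k ih =>
    obtain ⟨T, h1, h2, h3⟩ := ih fun l hl => hstep l (by omega)
    obtain ⟨T', h4, h5, h6⟩ := hstep k (by omega) ((range k).sup T) fun v =>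
      (deg_finset_sup_le T _ v).trans (sum_le_sum fun i hi => h2 i (mem_range.1 hi) v)
    rw [Finset.disjoint_sup_right] at h4
    have hne : ∀ l, l < k + 1 → l ≠ k → l < k := fun l h h' => by omega
    refine ⟨Function.update T k T', fun l hl => ?_, fun l hl => ?_, fun i hi j hj hij => ?_⟩
    · by_cases h : l = k
      · subst h; simpa using h5
      · rw [Function.update_of_ne h]; exact h1 l (hne l hl h)
    · by_cases h : l = k
      · subst h; simpa using h6
      · rw [Function.update_of_ne h]; exact h2 l (hne l hl h)
    · by_cases h : i = k
      · subst h
        rw [Function.update_self, Function.update_of_ne hij.symm]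
        exact h4 (mem_range.2 (hne j hj hij.symm))
      · by_cases h' : j = k
        · subst h'
          rw [Function.update_self, Function.update_of_ne hij]
          exact (h4 (mem_range.2 (hne i hi hij))).symm
        · rw [Function.update_of_ne h, Function.update_of_ne h']
          exact h3 i (hne i hi h) j (hne j hj h') hij

end Families

/-! ### The cut condition from mixing. -/

section Expansion

variable {V : Type*} [Fintype V] [DecidableEq V]

/-- The conclusion of the expander mixing lemma with `λ = d / 12`. -/
def IsMixing (G : SimpleGraph V) (d : ℕ) : Prop :=
  ∀ S T : Finset V, |(edgesBetween G S T : ℝ) - d * #S * #T / Fintype.card V| ≤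
    d / 12 * √(#S * #T)

/-- A small `S` sends many edges into `Q`, and mixing bounds how many of them can miss `T`. A large
`S` is joined to `T` directly by the mixing lower bound. -/
theorem edgesBetween_expansion [Nonempty V] {G : SimpleGraph V} {d : ℕ} (hmix : IsMixing G d)
    {Q S T : Finset V} (hT : T ⊆ Q) (hST : #S ≤ #T) (hlarge : 9 * (#Q - #T) ≤ 10 * #S)
    (hdeg : ∀ v ∈ S, 0.248 * (d : ℝ) ≤ degIn G v Q) :
    d * #S ≤ 40 * edgesBetween G S T := by
  have hn : (0 : ℝ) < Fintype.card V := by exact_mod_cast Fintype.card_pos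
  set n : ℝ := (Fintype.card V : ℝ)
  have hu : #(Q \ T) = #Q - #T := card_sdiff_of_subset hT
  rw [← hu] at hlarge
  have hlarge' : 9 * (#(Q \ T) : ℝ) ≤ 10 * #S := by exact_mod_cast hlarge
  have hST' : (#S : ℝ) ≤ #T := by exact_mod_cast hST
  have hs0 : (0 : ℝ) ≤ #S := Nat.cast_nonneg _
  have hu0 : (0 : ℝ) ≤ #(Q \ T) := Nat.cast_nonneg _
  have hd0 : (0 : ℝ) ≤ d := Nat.cast_nonneg _
  have goal : (d : ℝ) * #S ≤ 40 * edgesBetween G S T := by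
    -- With `#(Q \ T) ≤ (10/9) #S`, the first case leaves `0.248 - 0.12 * 10/9 - (19/9)/24 > 1/40`.
    -- The second leaves `0.12 - 1/12 > 1/40`.
    rcases le_or_gt (#S : ℝ) (0.12 * n) with hs | hs
    · have hsplit : (edgesBetween G S T : ℝ) + edgesBetween G S (Q \ T) =
          ∑ v ∈ S, (degIn G v Q : ℝ) := by
        unfold edgesBetween
        push_cast
        rw [← sum_add_distrib]
        refine sum_congr rfl fun v _ => ?_
        have := degIn_union G v (disjoint_sdiff : Disjoint T (Q \ T))
        rw [union_sdiff_of_subset hT] at this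
        exact_mod_cast this.symm
      have hsum : 0.248 * d * #S ≤ ∑ v ∈ S, (degIn G v Q : ℝ) := by
        have := sum_le_sum hdeg
        rw [sum_const, nsmul_eq_mul] at this
        linarith
      have h1 := (abs_le.1 (hmix S (Q \ T))).2
      have h2 : √((#S : ℝ) * #(Q \ T)) ≤ (#S + #(Q \ T)) / 2 := by
        rw [Real.sqrt_le_left (by positivity)]
        nlinarith [sq_nonneg ((#S : ℝ) - #(Q \ T))]
      have h3 : (d : ℝ) / 12 * √((#S : ℝ) * #(Q \ T)) ≤ d / 12 * ((#S + #(Q \ T)) / 2) := by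
        gcongr
      have h4 : (d : ℝ) * #S * #(Q \ T) / n ≤ 0.12 * (d * #(Q \ T)) := by
        rw [div_le_iff₀ hn]
        have := mul_le_mul_of_nonneg_left hs (by positivity : 0 ≤ (d : ℝ) * #(Q \ T))
        linarith
      have h5 := mul_le_mul_of_nonneg_left hlarge' hd0
      linarith
    · set g := √((#S : ℝ) * #T) with hg
      have hg2 : g ^ 2 = #S * #T := Real.sq_sqrt (by positivity)
      have hgs : (#S : ℝ) ≤ g := by
        rw [hg]
        refine Real.le_sqrt_of_sq_le ?_
        rw [sq]
        gcongr
      have h1 := (abs_le.1 (hmix S T)).1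
      have h2 : (d : ℝ) * #S * #T / n = d * g * (g / n) := by
        rw [mul_assoc, ← hg2]; ring
      have h3 : 0.12 ≤ g / n := by
        rw [le_div_iff₀ hn]; linarith
      have h4 : (d : ℝ) * g * 0.12 ≤ d * g * (g / n) := by gcongr
      have h5 := mul_le_mul_of_nonneg_left hgs hd0
      have h6 : (0 : ℝ) ≤ d * g := by positivity
      rw [h2] at h1
      linarith
  exact_mod_cast goal

/-- The cut condition for nearly constant demands between two halves of a mixing graph from which
a graph of small maximum degree has been removed. -/
theorem cut_condition_of_isMixing [Nonempty V] {G : SimpleGraph V} {d : ℕ} (hmix : IsMixing G d)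
    {P Q S T : Finset V} (hS : S ⊆ P) (hT : T ⊆ Q) {f : V → ℕ} {w ρ : ℕ}
    (hsum : ∑ v ∈ P, f v = ∑ v ∈ Q, f v) (hf : ∀ v, 9 * w ≤ f v ∧ f v ≤ 10 * w)
    (hdegS : ∀ v ∈ S, 0.248 * (d : ℝ) ≤ degIn G v Q)
    (hdegT : ∀ v ∈ T, 0.248 * (d : ℝ) ≤ degIn G v P) (hd : 40 * (ρ + 10 * w) ≤ d)
    {H : SimpleGraph V} (hHS : ∀ v ∈ S, degIn G v T ≤ degIn H v T + ρ)
    (hHT : ∀ v ∈ T, degIn G v S ≤ degIn H v S + ρ) :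
    ∑ v ∈ T, f v ≤ ∑ v ∈ P \ S, f v + edgesBetween H S T := by
  have hup : ∀ A : Finset V, ∑ v ∈ A, f v ≤ 10 * w * #A := by
    intro A
    rw [mul_comm, ← smul_eq_mul, ← sum_const]
    exact sum_le_sum fun v _ => (hf v).2
  have hlo : ∀ A : Finset V, 9 * w * #A ≤ ∑ v ∈ A, f v := by
    intro A
    rw [mul_comm, ← smul_eq_mul, ← sum_const]
    exact sum_le_sum fun v _ => (hf v).1
  have hPs : ∑ v ∈ P \ S, f v + ∑ v ∈ S, f v = ∑ v ∈ P, f v := sum_sdiff hS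
  have hQs : ∑ v ∈ Q \ T, f v + ∑ v ∈ T, f v = ∑ v ∈ Q, f v := sum_sdiff hT
  have hcP : #(P \ S) = #P - #S := card_sdiff_of_subset hS
  have hcQ : #(Q \ T) = #Q - #T := card_sdiff_of_subset hT
  have hweight : ∀ (A B : Finset V), 10 * #A ≤ 9 * #B → 10 * w * #A ≤ 9 * w * #B := by
    intro A B h
    have := Nat.mul_le_mul_left w h
    nlinarith
  have hclose : ∀ a : ℕ, 40 * (a * ρ) + 40 * (10 * w * a) ≤ d * a := fun a =>
    (le_of_eq (by ring)).trans (Nat.mul_le_mul_right a hd)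
  rcases le_total #S #T with hST | hST
  -- If `S` is small compared with `Q \ T`, then `f(S) ≤ f(Q \ T)`, and equality of the total
  -- demands gives the claim without any edges. Otherwise expansion gives `d * #S / 40` edges. At
  -- most `ρ * #S` of them are lost, and the rest pay for `f(S)`.
  · by_cases hl : 10 * #S ≤ 9 * (#Q - #T)
    · rw [← hcQ] at hl
      have := hweight _ _ hl
      have h1 := hup S
      have h2 := hlo (Q \ T)
      omega
    · have h1 := edgesBetween_expansion hmix hT hST (by omega) hdegS
      have h2 : edgesBetween G S T ≤ edgesBetween H S T + #S * ρ := by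
        unfold edgesBetween
        rw [← smul_eq_mul, ← sum_const, ← sum_add_distrib]
        exact sum_le_sum hHS
      have h3 := hclose #S
      have h4 := hup S
      omega
  · by_cases hl : 10 * #T ≤ 9 * (#P - #S)
    · rw [← hcP] at hl
      have := hweight _ _ hl
      have h1 := hup T
      have h2 := hlo (P \ S)
      omega
    · have h1 := edgesBetween_expansion hmix hS hST (by omega) hdegT
      have h2 : edgesBetween G T S ≤ edgesBetween H T S + #T * ρ := by
        unfold edgesBetween
        rw [← smul_eq_mul, ← sum_const, ← sum_add_distrib]
        exact sum_le_sum hHT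
      rw [edgesBetween_comm H T S] at h2
      have h3 := hclose #T
      have h4 := hup T
      omega

end Expansion

end RegBip

namespace RegBip

/-! ### Completing balanced pieces to regular ones. -/

section Completion

theorem sum_eq_sum_quadrants {V : Type*} (A : Finset V) (b : V → Bool) (f : V → ℕ) :
    ∑ v ∈ A, f v = ∑ v ∈ A with b v = true, f v + ∑ v ∈ A with b v = false, f v := by
  rw [← sum_filter_add_sum_filter_not A (fun v => b v = true)]
  simp

variable {V : Type*} [Fintype V] [DecidableEq V]

/-- In a mixing graph with balanced quadrants, nearly constant demands are met by a subgraph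
crossing both bipartitions and avoiding a given graph of small maximum degree. -/
theorem exists_crossing_subgraph [Nonempty V] {G : SimpleGraph V} {d : ℕ} (hmix : IsMixing G d)
    (x b : V → Bool) (hquad : ∀ v α γ, 0.248 * (d : ℝ) ≤ degIn G v {u | x u = α ∧ b u = γ})
    {f : V → ℕ} {w ρ : ℕ} (hf : ∀ v, 9 * w ≤ f v ∧ f v ≤ 10 * w)
    (hsum : ∀ γ, ∑ v with x v = true ∧ b v = γ, f v = ∑ v with x v = false ∧ b v = !γ, f v)
    (hd : 40 * (ρ + 10 * w) ≤ d) (U : SimpleGraph V) (hU : ∀ v, deg U v ≤ ρ) :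
    ∃ R ≤ G, Disjoint R U ∧ (∀ u v, R.Adj u v → x u ≠ x v ∧ b u ≠ b v) ∧ ∀ v, deg R v = f v := by
  let H : SimpleGraph V :=
    { Adj := fun u v => (G.Adj u v ∧ x u ≠ x v ∧ b u ≠ b v) ∧ ¬ U.Adj u v
      symm := ⟨fun u v h => ⟨⟨h.1.1.symm, h.1.2.1.symm, h.1.2.2.symm⟩, fun h' => h.2 h'.symm⟩⟩
      loopless := ⟨fun u h => h.1.1.ne rfl⟩ }
  have hdegH : ∀ v (A : Finset V), (∀ u ∈ A, x v ≠ x u ∧ b v ≠ b u) →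
      degIn G v A ≤ degIn H v A + ρ := by
    intro v A hA
    classical
    have h1 : degIn G v A ≤ degIn H v A + degIn U v A := by
      unfold degIn
      refine (card_le_card ?_).trans (card_union_le _ _)
      intro u hu
      simp only [mem_union, mem_filter] at hu ⊢
      have := hA u hu.1
      by_cases hUu : U.Adj v u
      · exact Or.inr ⟨hu.1, hUu⟩
      · exact Or.inl ⟨hu.1, ⟨hu.2, this⟩, hUu⟩
    have := (degIn_le_deg U v A).trans (hU v)
    omega
  obtain ⟨R, hRH, hR⟩ := exists_subgraph_deg_eq H x (fun u v h => h.1.2.1) f (by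
      rw [sum_eq_sum_quadrants _ b, sum_eq_sum_quadrants (univ.filter fun v => x v = false) b,
        filter_filter, filter_filter, filter_filter, filter_filter, hsum, hsum, add_comm]
      rfl) (by
    intro S T hS hT
    set X : Finset V := univ.filter fun v => x v = true with hX
    -- Edges crossing both bipartitions join opposite quadrants only, so the cut condition splits
    -- into two independent ones.
    have hkey : ∀ γ, ∑ v ∈ T with b v = !γ, f v ≤ ∑ v ∈ X \ S with b v = γ, f v +
        edgesBetween H (S.filter fun v => b v = γ) (T.filter fun v => b v = !γ) := by
      intro γ
      have h := cut_condition_of_isMixing hmix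
        (P := univ.filter fun v => x v = true ∧ b v = γ)
        (Q := univ.filter fun v => x v = false ∧ b v = !γ)
        (S := S.filter fun v => b v = γ) (T := T.filter fun v => b v = !γ)
        (fun v hv => by
          have := mem_filter.1 hv
          simp [hS v this.1, this.2])
        (fun v hv => by
          have := mem_filter.1 hv
          simp [hT v this.1, this.2])
        (hsum γ) hf (fun v _ => hquad v _ _) (fun v _ => hquad v _ _) hd (H := H)
        (fun v hv => hdegH v _ fun u hu => by
          have h1 := mem_filter.1 hv
          have h2 := mem_filter.1 hu
          rw [hS v h1.1, hT u h2.1, h1.2, h2.2]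
          cases γ <;> simp)
        (fun v hv => hdegH v _ fun u hu => by
          have h1 := mem_filter.1 hv
          have h2 := mem_filter.1 hu
          rw [hT v h1.1, hS u h2.1, h1.2, h2.2]
          cases γ <;> simp)
      refine h.trans (le_of_eq ?_)
      congr 2
      ext v
      simp only [mem_sdiff, mem_filter, mem_univ, true_and, hX]
      tauto
    have h1 := hkey true
    have h2 := hkey false
    simp only [Bool.not_true, Bool.not_false] at h1 h2
    have h3 : edgesBetween H (S.filter fun v => b v = true) (T.filter fun v => b v = false) +
        edgesBetween H (S.filter fun v => b v = false) (T.filter fun v => b v = true) ≤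
        edgesBetween H S T := by
      unfold edgesBetween
      rw [sum_eq_sum_quadrants S b]
      exact add_le_add (sum_le_sum fun v _ => degIn_mono le_rfl v (filter_subset _ _))
        (sum_le_sum fun v _ => degIn_mono le_rfl v (filter_subset _ _))
    rw [sum_eq_sum_quadrants T b, sum_eq_sum_quadrants (X \ S) b]
    omega)
  refine ⟨R, fun u v h => (hRH h).1.1, ?_, fun u v h => (hRH h).1.2, hR⟩
  rw [disjoint_iff_inf_le]
  intro u v huv
  exact (hRH huv.1).2 huv.2

theorem isBipartite_of_crossing {W : Type*} (H : SimpleGraph W) (b : W → Bool)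
    (hb : ∀ u v, H.Adj u v → b u ≠ b v) : H.IsBipartite := by
  have : H.Coloring Bool := SimpleGraph.Coloring.mk b fun {u v} h => hb u v h
  simpa using this.colorable

-- The union of the edge-disjoint regular pieces is regular, hence so is its complement in `G`. The
-- complement crosses `x` because the pieces cover every edge inside a side, so it serves as the
-- last piece.
omit [DecidableEq V] in
theorem isRegularBipartiteDecomposition_of_parts {G : SimpleGraph V} {d k : ℕ}
    (hG : ∀ v, deg G v = d) (x : V → Bool) (b : ℕ → V → Bool) (H : ℕ → SimpleGraph V)
    (hle : ∀ i < k, H i ≤ G) (hb : ∀ i < k, ∀ u v, (H i).Adj u v → b i u ≠ b i v)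
    (hreg : ∀ i < k, ∃ r, ∀ v, deg (H i) v = r)
    (hdis : ∀ i < k, ∀ j < k, i ≠ j → Disjoint (H i) (H j))
    (hcov : ∀ u v, G.Adj u v → x u = x v → ∃ i < k, (H i).Adj u v) :
    ∃ H' : Fin (k + 1) → SimpleGraph V, IsRegularBipartiteDecomposition G H' := by
  set A := (range k).sup H with hA
  have hAle : A ≤ G := Finset.sup_le fun i hi => hle i (mem_range.1 hi)
  have hHA : ∀ i < k, H i ≤ A := fun i hi => Finset.le_sup (f := H) (mem_range.2 hi)
  let H' : ℕ → SimpleGraph V := fun i => if i < k then H i else G \ A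
  have hlt : ∀ i, i < k → H' i = H i := fun i hi => if_pos hi
  have hge : ∀ i, ¬ i < k → H' i = G \ A := fun i hi => if_neg hi
  refine ⟨fun i => H' i, ⟨fun i => ?_, fun i => ?_, fun i => ?_, fun i j hij => ?_, ?_⟩⟩
  · by_cases hi : (i : ℕ) < k
    · simp only [hlt i hi]; exact hle i hi
    · simp only [hge i hi]; exact sdiff_le
  · by_cases hi : (i : ℕ) < k
    · simp only [hlt i hi]; exact isBipartite_of_crossing _ (b i) (hb i hi)
    · simp only [hge i hi]
      refine isBipartite_of_crossing _ x fun u v huv hx => ?_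
      obtain ⟨j, hj, hadj⟩ := hcov u v huv.1 hx
      exact huv.2 (hHA j hj hadj)
  · by_cases hi : (i : ℕ) < k
    · simp only [hlt i hi, isRegularGraph_iff]; exact hreg i hi
    · simp only [hge i hi, isRegularGraph_iff]
      have hAreg : ∃ r, ∀ v, deg A v = r := by
        choose! r hr using hreg
        refine ⟨∑ i ∈ range k, r i, fun v => ?_⟩
        rw [hA, deg_finset_sup]
        · exact sum_congr rfl fun i hi => hr i (mem_range.1 hi) v
        · exact fun i hi j hj => hdis i (mem_range.1 hi) j (mem_range.1 hj)
      obtain ⟨r, hr⟩ := hAreg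
      refine ⟨d - r, fun v => ?_⟩
      have := deg_sdiff_add hAle v
      rw [hr, hG] at this
      omega
  · rw [SimpleGraph.disjoint_edgeSet]
    have hij' : (i : ℕ) ≠ j := fun h => hij (Fin.ext h)
    by_cases hi : (i : ℕ) < k <;> by_cases hj : (j : ℕ) < k
    · rw [hlt i hi, hlt j hj]; exact hdis i hi j hj hij'
    · rw [hlt i hi, hge j hj]; exact disjoint_sdiff_self_right.mono_left (hHA i hi)
    · rw [hge i hi, hlt j hj]; exact disjoint_sdiff_self_left.mono_right (hHA j hj)
    · omega
  · refine subset_antisymm (Set.iUnion_subset fun i => ?_) fun e => ?_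
    · rw [SimpleGraph.edgeSet_subset_edgeSet]
      by_cases hi : (i : ℕ) < k
      · rw [hlt i hi]; exact hle i hi
      · rw [hge i hi]; exact sdiff_le
    · induction e using Sym2.ind with
      | _ u v =>
        intro huv
        rw [SimpleGraph.mem_edgeSet] at huv
        simp only [Set.mem_iUnion, SimpleGraph.mem_edgeSet]
        by_cases hAuv : A.Adj u v
        · rw [hA] at hAuv
          obtain ⟨i, hi, hadj⟩ := (finset_sup_adj H _ u v).1 hAuv
          rw [mem_range] at hi
          exact ⟨⟨i, by omega⟩, by simpa [hlt i hi] using hadj⟩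
        · exact ⟨⟨k, by omega⟩, by simpa [hge k (lt_irrefl k)] using ⟨huv, hAuv⟩⟩

/-- A mixing regular graph with bipartitions `x` and `β l`, all of whose sides are exchanged by a
common permutation of the vertices, such that every vertex has enough neighbours in each of the
four parts cut out by `x` and `β l`. -/
structure LevelSystem (G : SimpleGraph V) (d K : ℕ) (x : V → Bool) (β : ℕ → V → Bool) : Prop where
  mixing : IsMixing G d
  regular : ∀ v, deg G v = d
  pairing : ∃ σ : Equiv.Perm V, (∀ v, x (σ v) = !x v) ∧ ∀ l < K, ∀ v, β l (σ v) = !β l v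
  quadrants : ∀ l < K, ∀ v α γ, 0.248 * (d : ℝ) ≤ degIn G v {u | x u = α ∧ β l u = γ}

/-- The signed difference between the degree sums on the two sides of a bipartition. -/
noncomputable def imbalance (x : V → Bool) (H : SimpleGraph V) : ℤ :=
  ∑ v, (if x v = true then (deg H v : ℤ) else -deg H v)

omit [DecidableEq V] in
theorem imbalance_eq_sub (x : V → Bool) (H : SimpleGraph V) :
    imbalance x H =
      (∑ v with x v = true, deg H v : ℕ) - (∑ v with x v = false, deg H v : ℕ) := by
  unfold imbalance
  rw [sum_ite, sum_neg_distrib]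
  push_cast
  simp [sub_eq_add_neg]

omit [DecidableEq V] in
theorem card_quadrant_eq_of_pairing {x b : V → Bool} (σ : Equiv.Perm V) (hx : ∀ v, x (σ v) = !x v)
    (hb : ∀ v, b (σ v) = !b v) (α γ : Bool) :
    #{v | x v = α ∧ b v = γ} = #{v | x v = (!α) ∧ b v = !γ} := by
  refine card_nbij' σ σ.symm ?_ ?_ ?_ ?_
  · intro v hv
    simp only [coe_filter, mem_univ, true_and, Set.mem_ofPred_eq] at hv ⊢
    rw [hx, hb, hv.1, hv.2]; exact ⟨rfl, rfl⟩
  · intro v hv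
    simp only [coe_filter, mem_univ, true_and, Set.mem_ofPred_eq] at hv ⊢
    have h1 := hx (σ.symm v)
    have h2 := hb (σ.symm v)
    rw [σ.apply_symm_apply] at h1 h2
    rw [hv.1] at h1
    rw [hv.2] at h2
    exact ⟨(Bool.not_inj h1).symm, (Bool.not_inj h2).symm⟩
  · intro v _; simp
  · intro v _; simp

/-- Inside each side of `x`, the graph is bipartite between the two halves given by `b`. -/
theorem sum_deg_side_eq {x b : V → Bool} {F : SimpleGraph V}
    (hF : ∀ u v, F.Adj u v → x u = x v ∧ b u ≠ b v) (α : Bool) :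
    ∑ v with x v = α ∧ b v = true, deg F v = ∑ v with x v = α ∧ b v = false, deg F v := by
  refine sum_deg_eq_sum_deg _ _ _ ?_ ?_ <;>
  · intro v hv u huv
    have := hF v u huv
    simp only [mem_filter, mem_univ, true_and] at hv ⊢
    rw [hv.1, hv.2] at this
    refine ⟨this.1.symm, ?_⟩
    have h2 := this.2.symm
    revert h2
    cases b u <;> simp

/-- Bipartite pieces covering the edges inside the two sides of `x`, balanced between the two sides
and with nearly constant degrees, extend to a regular bipartite decomposition. -/
theorem LevelSystem.exists_decomposition_of_balanced [Nonempty V] {G : SimpleGraph V} {d K : ℕ}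
    {x : V → Bool} {β : ℕ → V → Bool} (hL : LevelSystem G d K x β) (F : ℕ → SimpleGraph V)
    (w : ℕ → ℕ) (hFG : ∀ l < K, F l ≤ G)
    (hFadj : ∀ l < K, ∀ u v, (F l).Adj u v → x u = x v ∧ β l u ≠ β l v)
    (hFdis : ∀ i < K, ∀ j < K, i ≠ j → Disjoint (F i) (F j))
    (hcov : ∀ u v, G.Adj u v → x u = x v → ∃ l < K, (F l).Adj u v)
    (hspread : ∀ l < K, ∀ u v, deg (F l) u ≤ deg (F l) v + w l)
    (hbal : ∀ l < K, imbalance x (F l) = 0)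
    (hw : 400 * ∑ l ∈ range K, w l ≤ d) :
    ∃ H : Fin (K + 1) → SimpleGraph V, IsRegularBipartiteDecomposition G H := by
  obtain ⟨σ, hσx, hσβ⟩ := hL.pairing
  have hmin : ∀ l, ∃ m, (∀ v, m ≤ deg (F l) v) ∧ (l < K → ∀ v, deg (F l) v ≤ m + w l) := by
    intro l
    obtain ⟨v0, -, hv0⟩ := exists_min_image (univ : Finset V) (deg (F l)) univ_nonempty
    exact ⟨deg (F l) v0, fun v => hv0 v (mem_univ v), fun hl v => hspread l hl v v0⟩
  choose lo hlo hhi using hmin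
  -- The common target degree is `lo l + 10 * w l`. Since `deg (F l) v` lies in `[lo l, lo l + w
  -- l]`, the demand lies in the window `[9 * w l, 10 * w l]` that the cut condition tolerates.
  let f : ℕ → V → ℕ := fun l v => lo l + 10 * w l - deg (F l) v
  have hf : ∀ l < K, ∀ v, f l v + deg (F l) v = lo l + 10 * w l := by
    intro l hl v
    have := hhi l hl v
    simp only [f]; omega
  -- The two quadrants within a side have equal degree sums, and the two sides are balanced, so all
  -- four quadrant sums agree.
  have hquadF : ∀ l < K, ∀ γ, ∑ v with x v = true ∧ β l v = γ, deg (F l) v =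
      ∑ v with x v = false ∧ β l v = !γ, deg (F l) v := by
    intro l hl γ
    have hside := sum_deg_side_eq (hFadj l hl)
    have h1 := hbal l hl
    rw [imbalance_eq_sub, sum_eq_sum_quadrants _ (β l),
      sum_eq_sum_quadrants (univ.filter fun v => x v = false) (β l), filter_filter, filter_filter,
      filter_filter, filter_filter, hside, hside] at h1
    cases γ
    · rw [Bool.not_false, hside]; omega
    · rw [Bool.not_true, hside]; omega
  obtain ⟨R, hR, -, hRdis⟩ := exists_disjoint_family K (fun l => 10 * w l)
    (fun l R => R ≤ G ∧ (∀ u v, R.Adj u v → x u ≠ x v ∧ β l u ≠ β l v) ∧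
      ∀ v, deg R v = f l v) (by
    intro l hl U hU
    obtain ⟨R, h1, h2, h3, h4⟩ := exists_crossing_subgraph hL.mixing x (β l) (hL.quadrants l hl)
      (f := f l) (w := w l) (ρ := ∑ i ∈ range l, 10 * w i)
      (fun v => by
        have h1 := hf l hl v
        have h2 := hhi l hl v
        have h3 := hlo l v
        omega)
      (fun γ => by
        have h1 : ∀ A : Finset V, ∑ v ∈ A, f l v + ∑ v ∈ A, deg (F l) v =
            #A * (lo l + 10 * w l) := by
          intro A
          rw [← sum_add_distrib, sum_congr rfl fun v _ => hf l hl v, sum_const, smul_eq_mul]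
        have h2 := h1 (univ.filter fun v => x v = true ∧ β l v = γ)
        have h3 := h1 (univ.filter fun v => x v = false ∧ β l v = !γ)
        rw [hquadF l hl, card_quadrant_eq_of_pairing σ hσx (hσβ l hl)] at h2
        rw [Bool.not_true] at h2
        omega)
      (by
        rw [← mul_sum, ← mul_add, ← sum_range_succ]
        have : ∑ i ∈ range (l + 1), w i ≤ ∑ i ∈ range K, w i :=
          sum_le_sum_of_subset (range_subset_range.2 hl)
        omega) U hU
    refine ⟨R, h2, ⟨h1, h3, h4⟩, fun v => ?_⟩
    rw [h4]
    have h1 := hf l hl v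
    have h3 := hlo l v
    omega)
  refine isRegularBipartiteDecomposition_of_parts hL.regular x β (fun l => F l ⊔ R l)
    (fun l hl => sup_le (hFG l hl) (hR l hl).1) ?_ ?_ ?_ ?_
  · rintro l hl u v (h | h)
    · exact (hFadj l hl u v h).2
    · exact ((hR l hl).2.1 u v h).2
  · intro l hl
    refine ⟨lo l + 10 * w l, fun v => ?_⟩
    rw [deg_sup, (hR l hl).2.2, add_comm, hf l hl]
    rw [disjoint_iff_inf_le]
    intro u v huv
    exact ((hR l hl).2.1 u v huv.2).1 (hFadj l hl u v huv.1).1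
  · intro i hi j hj hij
    have hFR : ∀ i < K, ∀ j < K, Disjoint (F i) (R j) := by
      intro i hi j hj
      rw [disjoint_iff_inf_le]
      intro u v huv
      exact ((hR j hj).2.1 u v huv.2).1 (hFadj i hi u v huv.1).1
    rw [disjoint_sup_left, disjoint_sup_right, disjoint_sup_right]
    exact ⟨⟨hFdis i hi j hj hij, hFR i hi j hj⟩, (hFR j hj i hi).symm, hRdis i hi j hj hij⟩
  · intro u v huv hx
    obtain ⟨l, hl, h⟩ := hcov u v huv hx
    exact ⟨l, hl, Or.inl h⟩

end Completion

end RegBip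

namespace RegBip

/-! ### Balancing the two sides by moving edges. -/

section Balancing

variable {V : Type*} [Fintype V] [DecidableEq V]

omit [DecidableEq V] in
theorem imbalance_sup (x : V → Bool) {H H' : SimpleGraph V} (h : Disjoint H H') :
    imbalance x (H ⊔ H') = imbalance x H + imbalance x H' := by
  unfold imbalance
  rw [← sum_add_distrib]
  refine sum_congr rfl fun v _ => ?_
  rw [deg_sup h]
  split_ifs <;> push_cast <;> ring

omit [DecidableEq V] in
theorem imbalance_sdiff_add (x : V → Bool) {H H' : SimpleGraph V} (h : H' ≤ H) :
    imbalance x (H \ H') + imbalance x H' = imbalance x H := by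
  rw [← imbalance_sup x disjoint_sdiff_self_left, sdiff_sup_cancel h]

omit [DecidableEq V] in
theorem imbalance_finset_sup (x : V → Bool) (T : ℕ → SimpleGraph V) (s : Finset ℕ)
    (hT : ∀ i ∈ s, ∀ j ∈ s, i ≠ j → Disjoint (T i) (T j)) :
    imbalance x (s.sup T) = ∑ i ∈ s, imbalance x (T i) := by
  unfold imbalance
  rw [sum_comm]
  refine sum_congr rfl fun v _ => ?_
  rw [deg_finset_sup T s hT]
  split_ifs <;> simp

theorem imbalance_of_crossing {x : V → Bool} {H : SimpleGraph V}
    (hH : ∀ u v, H.Adj u v → x u ≠ x v) : imbalance x H = 0 := by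
  rw [imbalance_eq_sub, sum_deg_eq_of_crossing H x hH, sub_self]

omit [DecidableEq V] in
theorem imbalance_of_side {x : V → Bool} {H : SimpleGraph V} {α : Bool}
    (hH : ∀ u v, H.Adj u v → x u = α) :
    imbalance x H = if α = true then ((∑ v, deg H v : ℕ) : ℤ) else -((∑ v, deg H v : ℕ) : ℤ) := by
  have hz : ∀ v, x v ≠ α → deg H v = 0 := by
    intro v hv
    unfold deg degIn
    rw [card_eq_zero]
    ext u
    simp only [mem_filter, mem_univ, true_and, notMem_empty, iff_false]
    exact fun h => hv (hH v u h)
  unfold imbalance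
  push_cast
  split_ifs with hα
  · refine sum_congr rfl fun v _ => ?_
    split_ifs with h
    · rfl
    · rw [hz v (by rw [hα]; exact h)]; simp
  · rw [← sum_neg_distrib]
    refine sum_congr rfl fun v _ => ?_
    split_ifs with h
    · rw [hz v (by rw [h]; exact fun h' => hα h'.symm)]; simp
    · rfl

omit [DecidableEq V] in
theorem card_side_eq {x : V → Bool} (σ : Equiv.Perm V) (hx : ∀ v, x (σ v) = !x v) (α : Bool) :
    #{v | x v = α} = #{v | x v = true} := by
  cases α
  · have := card_quadrant_eq_of_pairing σ hx hx true true
    simpa using this.symm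
  · rfl

omit [DecidableEq V] in
/-- Inside one side of `x`, there is a subgraph crossing two further bipartitions with a prescribed
number of edges and small maximum degree, avoiding a given graph of small maximum degree. -/
theorem exists_transfer {G : SimpleGraph V} {d : ℕ} (hd0 : 0 < d) (x b c : V → Bool) (α : Bool)
    (htrip : ∀ v β γ,
      |(degIn G v {u | x u = α ∧ b u = β ∧ c u = γ} : ℝ) - d / 8| ≤ d / 1000)
    (U : SimpleGraph V) {ρ w m : ℕ} (hU : ∀ v, deg U v ≤ ρ) (hρ : 900 * ρ ≤ d)
    (hw : 3600 * w ≤ d) (hm : 2 * m ≤ #{v | x v = α} * w) :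
    ∃ T ≤ G, Disjoint T U ∧
      (∀ u v, T.Adj u v → x u = α ∧ x v = α ∧ b u ≠ b v ∧ c u ≠ c v) ∧
      (∀ v, deg T v ≤ 4 * w) ∧ ∑ v, deg T v = 2 * m := by
  let Q : SimpleGraph V :=
    { Adj := fun u v => G.Adj u v ∧ x u = α ∧ x v = α ∧ b u ≠ b v ∧ c u ≠ c v
      symm := ⟨fun u v h => ⟨h.1.symm, h.2.2.1, h.2.1, h.2.2.2.1.symm, h.2.2.2.2.symm⟩⟩
      loopless := ⟨fun u h => h.1.ne rfl⟩ }
  have hQ1 : ∀ v, x v = α → deg Q v = degIn G v {u | x u = α ∧ b u = (!b v) ∧ c u = !c v} := by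
    intro v hv
    unfold deg degIn
    congr 1
    ext u
    simp only [Q, mem_filter, mem_univ, true_and]
    have e1 : b v ≠ b u ↔ b u = !b v := by cases b v <;> cases b u <;> simp
    have e2 : c v ≠ c u ↔ c u = !c v := by cases c v <;> cases c u <;> simp
    rw [e1, e2]
    tauto
  have hQ0 : ∀ v, x v ≠ α → deg Q v = 0 := by
    intro v hv
    unfold deg degIn
    rw [card_eq_zero]
    ext u
    simp only [Q, mem_filter, mem_univ, true_and, notMem_empty, iff_false]
    exact fun h => hv h.2.1
  -- On side `α` the degrees in `Q` are close to `d / 8`. They are at most `d / 7`, and at least `d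
  -- / 9` even after `U` is deleted, which leaves ample room for the greedy choice with `κ = 4 * w`.
  have hup : ∀ v, 7 * deg Q v ≤ d := by
    intro v
    by_cases hv : x v = α
    · rw [hQ1 v hv]
      have h1 := (abs_le.1 (htrip v (!b v) (!c v))).2
      have h2 : (0 : ℝ) ≤ d := Nat.cast_nonneg d
      have h3 : (7 : ℝ) * degIn G v {u | x u = α ∧ b u = (!b v) ∧ c u = !c v} ≤ d := by linarith
      exact_mod_cast h3
    · rw [hQ0 v hv]; omega
  have hlow : ∀ v, x v = α → d ≤ 9 * deg (Q \ U) v := by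
    intro v hv
    have h1 := (abs_le.1 (htrip v (!b v) (!c v))).1
    rw [← hQ1 v hv] at h1
    have h2 : deg Q v ≤ deg (Q \ U) v + deg U v := degIn_le_sdiff_add Q U v univ
    have h3 := hU v
    have h4 : (deg Q v : ℝ) ≤ deg (Q \ U) v + ρ := by
      exact_mod_cast h2.trans (Nat.add_le_add_left h3 _)
    have h5 : (900 : ℝ) * ρ ≤ d := by exact_mod_cast hρ
    have h6 : (d : ℝ) ≤ 9 * deg (Q \ U) v := by
      have : (0 : ℝ) ≤ d := Nat.cast_nonneg d
      linarith
    exact_mod_cast h6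
  set N := #{v | x v = α} with hN
  obtain ⟨T, hTQ, hT1, hT2⟩ := exists_subgraph_sum_deg_eq (Q \ U) (d / 7) m (4 * w)
    (fun v => by
      have h1 := hup v
      have h2 := deg_mono (sdiff_le : Q \ U ≤ Q) v
      omega) (fun hm0 => by
      have hNd : N * d ≤ 9 * ∑ v, deg (Q \ U) v := by
        calc N * d = ∑ v with x v = α, d := by rw [sum_const, smul_eq_mul]
          _ ≤ ∑ v with x v = α, 9 * deg (Q \ U) v :=
            sum_le_sum fun v hv => hlow v (mem_filter.1 hv).2
          _ = 9 * ∑ v with x v = α, deg (Q \ U) v := (mul_sum _ _ _).symm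
          _ ≤ _ := Nat.mul_le_mul_left _ (sum_le_sum_of_subset (filter_subset _ _))
      have hNw : 0 < N * w := by omega
      set E := ∑ v, deg (Q \ U) v
      have hdiv : 7 * (d / 7) ≤ d := Nat.mul_div_le d 7
      have h1 : 63 * (2 * m * (4 * w) + 4 * m * (d / 7)) ≤ N * w * (252 * w + 18 * d) := by
        calc 63 * (2 * m * (4 * w) + 4 * m * (d / 7))
            = 2 * m * (252 * w + 18 * (7 * (d / 7))) := by ring
          _ ≤ N * w * (252 * w + 18 * d) := by gcongr
      have h2 : N * w * (252 * w + 18 * d) < N * w * (28 * d) :=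
        Nat.mul_lt_mul_of_pos_left (by omega) hNw
      have h3 : N * w * (28 * d) ≤ 63 * (4 * w * E) := by
        calc N * w * (28 * d) = 28 * w * (N * d) := by ring
          _ ≤ 28 * w * (9 * E) := Nat.mul_le_mul_left _ hNd
          _ = _ := by ring
      omega)
  refine ⟨T, fun u v h => (hTQ h).1.1, ?_, fun u v h => (hTQ h).1.2, hT1, hT2⟩
  rw [disjoint_iff_inf_le]
  intro u v h
  exact (hTQ h.1).2 h.2

/-- The degree sum over each side is twice that over one of its halves. Evenness matters because an
edge added inside a side shifts the imbalance by two. -/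
theorem even_imbalance {x b : V → Bool} {F : SimpleGraph V}
    (hF : ∀ u v, F.Adj u v → x u = x v ∧ b u ≠ b v) : Even (imbalance x F) := by
  have h := sum_deg_side_eq hF
  rw [imbalance_eq_sub, sum_eq_sum_quadrants _ b,
    sum_eq_sum_quadrants (univ.filter fun v => x v = false) b, filter_filter, filter_filter,
    filter_filter, filter_filter, h, h]
  push_cast
  exact Even.sub ⟨_, rfl⟩ ⟨_, rfl⟩

omit [DecidableEq V] in
theorem abs_imbalance_le [Nonempty V] {x : V → Bool} (σ : Equiv.Perm V) (hx : ∀ v, x (σ v) = !x v)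
    {F : SimpleGraph V} {w : ℕ} (hF : ∀ u v, deg F u ≤ deg F v + w) :
    |imbalance x F| ≤ (#{v | x v = true} * w : ℕ) := by
  obtain ⟨v0, -, hv0⟩ := exists_min_image (univ : Finset V) (deg F) univ_nonempty
  have hlo : ∀ α, #{v | x v = true} * deg F v0 ≤ ∑ v with x v = α, deg F v := by
    intro α
    rw [← card_side_eq σ hx α, ← smul_eq_mul, ← sum_const]
    exact sum_le_sum fun v _ => hv0 v (mem_univ v)
  have hhi : ∀ α, ∑ v with x v = α, deg F v ≤
      #{v | x v = true} * deg F v0 + #{v | x v = true} * w := by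
    intro α
    rw [← mul_add, ← card_side_eq σ hx α, ← smul_eq_mul, ← sum_const]
    exact sum_le_sum fun v _ => hF v v0
  rw [imbalance_eq_sub, abs_le]
  have h1 := hlo true
  have h2 := hlo false
  have h3 := hhi true
  have h4 := hhi false
  constructor <;> omega

/-- Bipartite pieces with nearly constant degrees covering the edges inside the two sides of `x`
can be rebalanced by moving edges out of the first piece, and hence give rise to a regular
bipartite decomposition. -/
theorem LevelSystem.exists_decomposition [Nonempty V] {G : SimpleGraph V} {d K : ℕ}
    {x : V → Bool} {β : ℕ → V → Bool} (hL : LevelSystem G d K x β) (hd0 : 0 < d) (hK : 0 < K)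
    (F : ℕ → SimpleGraph V) (w : ℕ → ℕ) (hFG : ∀ l < K, F l ≤ G)
    (hFadj : ∀ l < K, ∀ u v, (F l).Adj u v → x u = x v ∧ β l u ≠ β l v)
    (hF0 : ∀ u v, G.Adj u v → x u = x v → β 0 u ≠ β 0 v → (F 0).Adj u v)
    (hFdis : ∀ i < K, ∀ j < K, i ≠ j → Disjoint (F i) (F j))
    (hcov : ∀ u v, G.Adj u v → x u = x v → ∃ l < K, (F l).Adj u v)
    (hspread : ∀ l < K, ∀ u v, deg (F l) u ≤ deg (F l) v + w l)
    (htrip : ∀ l < K, l ≠ 0 → ∀ v α γ δ,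
      |(degIn G v {u | x u = α ∧ β 0 u = γ ∧ β l u = δ} : ℝ) - d / 8| ≤ d / 1000)
    (hw : 3600 * ∑ l ∈ range K, w l ≤ d) :
    ∃ H : Fin (K + 1) → SimpleGraph V, IsRegularBipartiteDecomposition G H := by
  obtain ⟨σ, hσx, hσβ⟩ := hL.pairing
  set W := ∑ l ∈ range K, w l with hW
  have hwle : ∀ l < K, w l ≤ W := fun l hl =>
    single_le_sum (f := w) (fun i _ => Nat.zero_le _) (mem_range.2 hl)
  obtain ⟨T, hT, hTdeg, hTdis⟩ := exists_disjoint_family K (fun l => 4 * w l)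
    (fun l T => T ≤ F 0 ∧ (∀ u v, T.Adj u v → β l u ≠ β l v) ∧ (l = 0 → T = ⊥) ∧
      imbalance x T = if l = 0 then 0 else -imbalance x (F l)) (by
    intro l hl U hU
    by_cases hl0 : l = 0
    · exact ⟨⊥, disjoint_bot_left, ⟨bot_le, by simp, fun _ => rfl, by simp [hl0, imbalance]⟩, by simp⟩
    · obtain ⟨m, hm⟩ := even_imbalance (hFadj l hl)
      have habs := abs_imbalance_le σ hσx (hspread l hl)
      -- The imbalance is `m + m`, so `|m|` edges inside the side with the smaller degree sum cancel
      -- it. Crossing `β 0` places them in `F 0`, and crossing `β l` keeps the enlarged piece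
      -- bipartite.
      obtain ⟨T, h1, h2, h3, h4, h5⟩ := exists_transfer hd0 x (β 0) (β l) (decide (m < 0))
        (fun v γ δ => htrip l hl hl0 v _ γ δ) U (w := w l) (m := m.natAbs) hU
        (by
          rw [← mul_sum]
          have : ∑ i ∈ range l, w i ≤ W := sum_le_sum_of_subset (range_subset_range.2 hl.le)
          omega)
        (by have := hwle l hl; omega)
        (by
          rw [card_side_eq σ hσx]
          rw [abs_le] at habs
          omega)
      refine ⟨T, h2, ⟨fun u v h => ?_, fun u v h => (h3 u v h).2.2.2, fun h => absurd h hl0, ?_⟩, h4⟩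
      · have := h3 u v h
        exact hF0 u v (h1 h) (this.1.trans this.2.1.symm) this.2.2.1
      · rw [imbalance_of_side (fun u v h => (h3 u v h).1), h5, if_neg hl0]
        by_cases hm0 : m < 0
        · simp only [hm0, decide_true, if_true]; omega
        · simp only [hm0, decide_false, Bool.false_eq_true, if_false]; omega)
  set A := (range K).sup T with hA
  have hAF : A ≤ F 0 := Finset.sup_le fun l hl => (hT l (mem_range.1 hl)).1
  have hTA : ∀ l < K, T l ≤ A := fun l hl => Finset.le_sup (f := T) (mem_range.2 hl)
  have hAdeg : ∀ v, deg A v ≤ 4 * W := fun v => by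
    rw [hW, mul_sum]
    exact (deg_finset_sup_le T _ v).trans (sum_le_sum fun l hl => hTdeg l (mem_range.1 hl) v)
  have hFT : ∀ l < K, l ≠ 0 → ∀ i < K, Disjoint (F l) (T i) := fun l hl hl0 i hi =>
    (hFdis l hl 0 hK hl0).mono_right (hT i hi).1
  let F' : ℕ → SimpleGraph V := fun l => if l = 0 then F 0 \ A else F l ⊔ T l
  have hF'0 : F' 0 = F 0 \ A := if_pos rfl
  have hF'l : ∀ l, l ≠ 0 → F' l = F l ⊔ T l := fun l hl => if_neg hl
  have hTadj : ∀ l < K, ∀ u v, (T l).Adj u v → x u = x v := fun l hl u v h =>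
    (hFadj 0 hK u v ((hT l hl).1 h)).1
  -- Deleting `A` costs `F 0` up to `4 * W` per vertex, and adding `T l` costs `F l` up to `4 * w
  -- l`. The new spreads total at most `9 * W`, and `3600 = 9 * 400`.
  refine hL.exists_decomposition_of_balanced F' (fun l => if l = 0 then w 0 + 4 * W else 5 * w l)
    ?_ ?_ ?_ ?_ ?_ ?_ ?_
  · intro l hl
    by_cases hl0 : l = 0
    · subst hl0; rw [hF'0]; exact sdiff_le.trans (hFG 0 hK)
    · rw [hF'l l hl0]; exact sup_le (hFG l hl) ((hT l hl).1.trans (hFG 0 hK))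
  · intro l hl u v huv
    by_cases hl0 : l = 0
    · subst hl0; rw [hF'0] at huv; exact hFadj 0 hK u v huv.1
    · rw [hF'l l hl0] at huv
      rcases huv with h | h
      · exact hFadj l hl u v h
      · exact ⟨hTadj l hl u v h, (hT l hl).2.1 u v h⟩
  · have h0 : ∀ j < K, j ≠ 0 → Disjoint (F' 0) (F' j) := by
      intro j hj hj0
      rw [hF'0, hF'l j hj0, disjoint_sup_right]
      exact ⟨(hFdis 0 hK j hj (Ne.symm hj0)).mono_left sdiff_le,
        disjoint_sdiff_self_left.mono_right (hTA j hj)⟩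
    intro i hi j hj hij
    by_cases hi0 : i = 0
    · subst hi0; exact h0 j hj hij.symm
    · by_cases hj0 : j = 0
      · subst hj0; exact (h0 i hi hi0).symm
      · rw [hF'l i hi0, hF'l j hj0, disjoint_sup_left, disjoint_sup_right, disjoint_sup_right]
        exact ⟨⟨hFdis i hi j hj hij, hFT i hi hi0 j hj⟩, (hFT j hj hj0 i hi).symm,
          hTdis i hi j hj hij⟩
  · intro u v huv hx
    obtain ⟨l, hl, h⟩ := hcov u v huv hx
    by_cases hl0 : l = 0
    · subst hl0
      by_cases hAuv : A.Adj u v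
      · obtain ⟨i, hi, hadj⟩ := (finset_sup_adj T _ u v).1 hAuv
        rw [mem_range] at hi
        refine ⟨i, hi, ?_⟩
        have hi0 : i ≠ 0 := by
          rintro rfl
          rw [(hT 0 hK).2.2.1 rfl] at hadj
          exact hadj
        rw [hF'l i hi0]; exact Or.inr hadj
      · exact ⟨0, hK, by rw [hF'0]; exact ⟨h, hAuv⟩⟩
    · exact ⟨l, hl, by rw [hF'l l hl0]; exact Or.inl h⟩
  · intro l hl u v
    by_cases hl0 : l = 0
    · subst hl0
      rw [hF'0, if_pos rfl]
      have h1 := deg_sdiff_add hAF u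
      have h2 := deg_sdiff_add hAF v
      have h3 := hspread 0 hK u v
      have h4 := hAdeg v
      omega
    · rw [hF'l l hl0, if_neg hl0, deg_sup (hFT l hl hl0 l hl), deg_sup (hFT l hl hl0 l hl)]
      have h1 := hspread l hl u v
      have h2 := hTdeg l hl u
      omega
  · have hl : ∀ l < K, l ≠ 0 → imbalance x (F' l) = 0 := by
      intro l hl hl0
      rw [hF'l l hl0, imbalance_sup x (hFT l hl hl0 l hl), (hT l hl).2.2.2, if_neg hl0]
      ring
    -- `G` is regular with sides of equal size, and edges crossing `x` contribute nothing. So the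
    -- imbalances cancel in total, and correcting all pieces with `l ≠ 0` corrects `F 0` as well.
    have hFsum : ∑ l ∈ range K, imbalance x (F l) = 0 := by
      have hle : (range K).sup F ≤ G := Finset.sup_le fun l hl => hFG l (mem_range.1 hl)
      have hG : imbalance x G = 0 := by
        rw [imbalance_eq_sub]
        simp only [hL.regular, sum_const, card_side_eq σ hσx]
        simp
      have hcr : imbalance x (G \ (range K).sup F) = 0 := by
        refine imbalance_of_crossing fun u v huv hx => ?_
        obtain ⟨l, hl, h⟩ := hcov u v huv.1 hx
        exact huv.2 (Finset.le_sup (f := F) (mem_range.2 hl) h)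
      have := imbalance_sdiff_add x hle
      rw [hG, hcr, zero_add, imbalance_finset_sup] at this
      · exact this
      · exact fun i hi j hj => hFdis i (mem_range.1 hi) j (mem_range.1 hj)
    have hTsum : imbalance x A = ∑ l ∈ range K, imbalance x (T l) :=
      imbalance_finset_sup x T _ fun i hi j hj => hTdis i (mem_range.1 hi) j (mem_range.1 hj)
    have h0 : imbalance x (F' 0) = 0 := by
      have h1 := imbalance_sdiff_add x hAF
      have h2 : ∑ l ∈ range K, (imbalance x (T l) + imbalance x (F l)) = imbalance x (F 0) := by
        rw [sum_eq_single_of_mem 0 (mem_range.2 hK)]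
        · rw [(hT 0 hK).2.2.2, if_pos rfl, zero_add]
        · intro l hl hl0
          rw [(hT l (mem_range.1 hl)).2.2.2, if_neg hl0]
          ring
      rw [sum_add_distrib, hFsum, ← hTsum, add_zero] at h2
      rw [hF'0]
      omega
    intro l hlK
    by_cases hl0 : l = 0
    · subst hl0; exact h0
    · exact hl l hlK hl0
  · have : ∑ l ∈ range K, (if l = 0 then w 0 + 4 * W else 5 * w l) ≤ 9 * W := by
      calc ∑ l ∈ range K, (if l = 0 then w 0 + 4 * W else 5 * w l)
          ≤ ∑ l ∈ range K, (5 * w l + if l = 0 then 4 * W else 0) := by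
            refine sum_le_sum fun l _ => ?_
            split_ifs with h
            · subst h; omega
            · omega
        _ = 9 * W := by
            rw [sum_add_distrib, ← mul_sum, sum_ite_eq' (range K) 0 fun _ => 4 * W,
              if_pos (mem_range.2 hK), ← hW]
            ring
    omega

end Balancing

end RegBip

namespace RegBip

/-! ### Bipartitions from random bits and halving cuts. -/

section PairedBits

variable {V P : Type*} [Fintype V] [DecidableEq V] [Fintype P] [DecidableEq P]

-- The halving cuts are applied to the weights counting edges between distinct pairs, whose row sums
-- are at most `2 * d`. Labelling pairs rather than vertices gives partners the same label.
omit [DecidableEq V] in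
theorem exists_pair_labelling (pr : V → P) (hpr : ∀ p, #{v | pr v = p} ≤ 2) (G : SimpleGraph V)
    {d : ℕ} (hG : ∀ v, deg G v = d) :
    ∃ j : ℕ → P → Bool, ∀ k v,
      2 ^ k * degIn G v {u | pr u ≠ pr v ∧ ∀ i < k, j i (pr u) = j i (pr v)} ≤ 2 * d := by
  let fib : P → Finset V := fun p => univ.filter fun v => pr v = p
  let w : P → P → ℕ := fun p q => if q = p then 0 else edgesBetween G (fib p) (fib q)
  obtain ⟨j, hj⟩ := exists_iterated_halving w
    (fun p q => by simp only [w, eq_comm, edgesBetween_comm G (fib p)]) (fun p => by simp [w])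
  have hfiber : ∀ v (A : Finset V), degIn G v A = ∑ q, degIn G v (A.filter fun u => pr u = q) := by
    intro v A
    classical
    unfold degIn
    rw [card_eq_sum_card_fiberwise (f := pr) (t := univ) (fun _ _ => by simp)]
    simp only [filter_filter, and_comm]
  have htot : ∀ p, ∑ q, w p q ≤ 2 * d := by
    intro p
    calc ∑ q, w p q ≤ ∑ q, edgesBetween G (fib p) (fib q) := by
          refine sum_le_sum fun q _ => ?_
          simp only [w]; split_ifs <;> omega
      _ = ∑ v ∈ fib p, deg G v := by
          unfold edgesBetween
          rw [sum_comm]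
          exact sum_congr rfl fun v _ => (hfiber v univ).symm
      _ = #(fib p) * d := by rw [sum_congr rfl fun v _ => hG v, sum_const, smul_eq_mul]
      _ ≤ 2 * d := Nat.mul_le_mul_right _ (hpr p)
  refine ⟨j, fun k v => le_trans (Nat.mul_le_mul_left _ ?_) ((hj k (pr v)).trans (htot _))⟩
  rw [hfiber, sum_filter]
  refine sum_le_sum fun q _ => ?_
  by_cases hq : q = pr v
  · rw [show ((univ.filter fun u => pr u ≠ pr v ∧ ∀ i < k, j i (pr u) = j i (pr v)).filter
      fun u => pr u = q) = ∅ by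
        ext u
        simp only [mem_filter, mem_univ, true_and, notMem_empty, iff_false]
        rintro ⟨⟨h, _⟩, h'⟩
        exact h (h'.trans hq)]
    simp [degIn]
  · by_cases hjq : ∀ i < k, j i q = j i (pr v)
    · rw [if_pos hjq]
      simp only [w, if_neg hq]
      refine (degIn_mono le_rfl v (T' := fib q) fun u hu => ?_).trans
        (single_le_sum (f := fun v => degIn G v (fib q)) (fun _ _ => Nat.zero_le _)
          (show v ∈ fib (pr v) by simp [fib]))
      simp only [fib, mem_filter, mem_univ, true_and] at hu ⊢
      exact hu.2
    · rw [show ((univ.filter fun u => pr u ≠ pr v ∧ ∀ i < k, j i (pr u) = j i (pr v)).filter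
        fun u => pr u = q) = ∅ by
          ext u
          simp only [mem_filter, mem_univ, true_and, notMem_empty, iff_false]
          rintro ⟨⟨_, h⟩, rfl⟩
          exact hjq h]
      simp [degIn]

/-- The random bit used by the `l`-th bipartition. -/
def bitIndex (l : ℕ) : Fin 20 :=
  if h : l < 19 then ⟨l + 1, by omega⟩ else 19

theorem bitIndex_of_lt {l : ℕ} (h : l < 19) : bitIndex l = ⟨l + 1, by omega⟩ := dif_pos h

theorem bitIndex_of_le {l : ℕ} (h : 19 ≤ l) : bitIndex l = 19 := dif_neg (by omega)

/-- Bit 0 defines `x` and bit 1 defines `β 0`, so a triple with `β l` involves three distinct bits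
and has expected proportion `1/8`. -/
theorem bitIndex_ne {l : ℕ} (h : l ≠ 0) : bitIndex l ≠ 0 ∧ bitIndex l ≠ 1 := by
  rcases lt_or_ge l 19 with h' | h'
  · rw [bitIndex_of_lt h']
    refine ⟨by simp [Fin.ext_iff], ?_⟩
    simp [Fin.ext_iff]
    omega
  · rw [bitIndex_of_le h']
    decide

/-- Bits of the pairs such that all vertices see every prefix, and every triple of bipartitions
involving the first two, about equally often. -/
theorem exists_balanced_bits (pr : V → P) (e : V → Bool) (hpr : ∀ p, #{v | pr v = p} ≤ 2)
    (G : SimpleGraph V) {d K : ℕ} (hd0 : 0 < d) (hG : ∀ v, deg G v = d) (t : ℕ → P → Bool)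
    {ε : ℝ} (hε0 : 0 ≤ ε) (hε1 : ε ≤ 1)
    (hsize : 16 * (d : ℝ) ^ 2 * (21 * 2 ^ 20 + 8 * K) * Real.exp (-(ε ^ 2 * d / 16)) ≤ 1) :
    ∃ c : V → Fin 20 → Bool, (∀ u v, pr u = pr v → ∀ i, (c u i ^^ e u) = (c v i ^^ e v)) ∧
      (∀ v (a : Fin 20 → Bool), ∀ k ≤ 20,
        |(degIn G v {u | ∀ i : Fin 20, (i : ℕ) < k → c u i = a i} : ℝ) - d / 2 ^ k| ≤ ε * d) ∧
      ∀ v, ∀ l < K, l ≠ 0 → ∀ α γ δ,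
        |(degIn G v {u | c u 0 = α ∧ c u 1 = γ ∧ (c u (bitIndex l) ^^ t l (pr u)) = δ} : ℝ) -
          d / 8| ≤ ε * d := by
  let I := (Fin 21 × (Fin 20 → Bool)) ⊕ (Fin K × Bool × Bool × Bool)
  let S : I → Finset (Fin 20) := fun τ => match τ with
    | .inl (k, _) => univ.filter fun i : Fin 20 => (i : ℕ) < k
    | .inr (l, _) => {0, 1, bitIndex l}
  -- The required values are shifted by `e u`, and by the label on the third bit, to turn conditions
  -- on the vertex bits into conditions on the random bits of the pair.
  let a : I → V → Fin 20 → Bool := fun τ u i => match τ with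
    | .inl (_, b) => b i ^^ e u
    | .inr (l, α, γ, δ) => (if i = 0 then α else if i = 1 then γ else δ ^^ t l (pr u)) ^^ e u
  have hcard : (Fintype.card I : ℝ) = 21 * 2 ^ 20 + 8 * K := by
    have : Fintype.card I = 21 * 2 ^ 20 + K * 8 := by
      simp [I]
    rw [this]; push_cast; ring
  obtain ⟨ω, hω⟩ := exists_even_split pr hpr G hd0 hG S a hε0 hε1 (by rw [hcard]; exact hsize)
  have hx : ∀ p q r : Bool, (p ^^ q) = r ↔ p = (r ^^ q) := by decide
  have hx2 : ∀ p q r s : Bool, ((p ^^ q) ^^ r) = s ↔ p = ((s ^^ r) ^^ q) := by decide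
  refine ⟨fun v i => ω (pr v) i ^^ e v, fun u v h i => by simp [h], fun v b k hk => ?_,
    fun v l hl hl0 α γ δ => ?_⟩
  · have h := hω v (.inl (⟨k, by omega⟩, b))
    have hc : #(S (.inl (⟨k, by omega⟩, b))) = k := by
      simp only [S]
      rw [Fin.card_filter_val_lt]
      omega
    rw [hc] at h
    have hs : (univ.filter fun u => ∀ i : Fin 20, (i : ℕ) < k → (ω (pr u) i ^^ e u) = b i) =
        univ.filter fun u => ∀ i ∈ S (.inl (⟨k, by omega⟩, b)),
          ω (pr u) i = a (.inl (⟨k, by omega⟩, b)) u i := by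
      ext u
      simp only [S, a, mem_filter, mem_univ, true_and, hx]
    rw [hs]
    exact h
  · have h := hω v (.inr (⟨l, hl⟩, α, γ, δ))
    obtain ⟨hb0, hb1⟩ := bitIndex_ne hl0
    have hc : #(S (.inr (⟨l, hl⟩, α, γ, δ))) = 3 := by
      simp only [S]
      exact card_eq_three.2 ⟨0, 1, bitIndex l, by decide, hb0.symm, hb1.symm, rfl⟩
    rw [hc] at h
    have hs : (univ.filter fun u => (ω (pr u) 0 ^^ e u) = α ∧ (ω (pr u) 1 ^^ e u) = γ ∧
        ((ω (pr u) (bitIndex l) ^^ e u) ^^ t l (pr u)) = δ) =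
        univ.filter fun u => ∀ i ∈ S (.inr (⟨l, hl⟩, α, γ, δ)),
          ω (pr u) i = a (.inr (⟨l, hl⟩, α, γ, δ)) u i := by
      ext u
      simp only [S, a, mem_filter, mem_univ, true_and, mem_insert, mem_singleton,
        forall_eq_or_imp, forall_eq, if_true, if_neg hb0, if_neg hb1, hx2, hx]
      simp
    rw [hs]
    norm_num at h ⊢
    exact h

/-- The 19 random levels contribute `2 * E` each and the next 20 at most `3 * E` each. Beyond them
the halving bound is a geometric series starting at `2 * d / 2 ^ 20`. The total is about `102 * E`.
-/
theorem sum_level_spread_le {d E : ℕ} (hE : E = d / 2 ^ 20) (m : ℕ) :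
    3600 * ∑ l ∈ range (19 + m), (if l < 19 then 2 * E else min (3 * E) (2 * d / 2 ^ (l - 19))) ≤
      d := by
  have h1 : ∑ l ∈ range (19 + m), (if l < 19 then 2 * E else min (3 * E) (2 * d / 2 ^ (l - 19))) =
      38 * E + ∑ i ∈ range m, min (3 * E) (2 * d / 2 ^ i) := by
    have hlo : ∑ l ∈ range 19, (if l < 19 then 2 * E else min (3 * E) (2 * d / 2 ^ (l - 19))) =
        38 * E := by
      rw [sum_congr rfl fun l hl => if_pos (mem_range.1 hl), sum_const, card_range, smul_eq_mul]
      ring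
    rw [sum_range_add, hlo]
    refine congrArg _ (sum_congr rfl fun i _ => ?_)
    rw [if_neg (by omega), Nat.add_sub_cancel_left]
  have h2 : ∑ i ∈ range m, min (3 * E) (2 * d / 2 ^ i) ≤
      60 * E + ∑ i ∈ range m, 2 * d / 2 ^ 20 / 2 ^ i := by
    calc ∑ i ∈ range m, min (3 * E) (2 * d / 2 ^ i)
        ≤ ∑ i ∈ range (20 + m), min (3 * E) (2 * d / 2 ^ i) :=
          sum_le_sum_of_subset (range_subset_range.2 (by omega))
      _ = ∑ i ∈ range 20, min (3 * E) (2 * d / 2 ^ i) +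
          ∑ i ∈ range m, min (3 * E) (2 * d / 2 ^ (20 + i)) := sum_range_add _ _ _
      _ ≤ ∑ i ∈ range 20, 3 * E + ∑ i ∈ range m, 2 * d / 2 ^ 20 / 2 ^ i := by
          refine add_le_add (sum_le_sum fun i _ => min_le_left _ _) (sum_le_sum fun i _ => ?_)
          rw [Nat.div_div_eq_div_mul, ← pow_add]
          exact min_le_right _ _
      _ = _ := by
          rw [sum_const, card_range, smul_eq_mul]
          ring
  have h3 := Nat.geom_sum_le (le_refl 2) (2 * d / 2 ^ 20) m
  rw [h1]
  generalize ∑ i ∈ range m, min (3 * E) (2 * d / 2 ^ i) = A at h2 ⊢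
  generalize ∑ i ∈ range m, 2 * d / 2 ^ 20 / 2 ^ i = B at h2 h3
  omega

/-- A mixing regular graph on a set of pairs of vertices decomposes into few regular bipartite
spanning subgraphs. -/
theorem exists_decomposition_of_isMixing [Nonempty V] (φ : V ≃ P × Bool) (G : SimpleGraph V)
    {d : ℕ} (hd : 2 ^ 20 ≤ d) (hG : ∀ v, deg G v = d) (hmix : IsMixing G d)
    (hsize : 16 * (d : ℝ) ^ 2 * (21 * 2 ^ 20 + 8 * (21 + Nat.log 2 d : ℕ)) *
      Real.exp (-(((1 / 2) ^ 21) ^ 2 * d / 16)) ≤ 1) :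
    ∃ H : Fin (22 + Nat.log 2 d) → SimpleGraph V, IsRegularBipartiteDecomposition G H := by
  have hd0 : 0 < d := lt_of_lt_of_le (by norm_num) hd
  let pr : V → P := fun v => (φ v).1
  let e : V → Bool := fun v => (φ v).2
  have hpe : ∀ u v, pr u = pr v → e u = e v → u = v := fun u v h1 h2 =>
    φ.injective (Prod.ext h1 h2)
  have hpr : ∀ p, #{v | pr v = p} ≤ 2 := by
    intro p
    rw [← Fintype.card_bool, ← card_univ]
    refine card_le_card_of_injOn e (fun _ _ => by simp) fun u hu v hv h => ?_
    simp only [coe_filter, mem_univ, true_and, Set.mem_ofPred_eq] at hu hv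
    exact hpe u v (hu.trans hv.symm) h
  obtain ⟨j, hj⟩ := exists_pair_labelling pr hpr G hG
  let t : ℕ → P → Bool := fun l p => if l < 19 then false else j (l - 19) p
  set m := Nat.log 2 d + 2 with hm
  set K := 21 + Nat.log 2 d with hK
  have hKm : K = 19 + m := by omega
  obtain ⟨c, hce, hpre, htri⟩ := exists_balanced_bits pr e hpr G hd0 hG t (K := K)
    (by positivity : (0 : ℝ) ≤ (1 / 2) ^ 21) (by norm_num) hsize
  let x : V → Bool := fun v => c v 0
  -- Partners have complementary bits and equal labels, so they lie on opposite sides of every `β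
  -- l`. The random bit keeps the quadrants balanced even though the labels carry no such guarantee.
  let β : ℕ → V → Bool := fun l v => c v (bitIndex l) ^^ t l (pr v)
  have hβlt : ∀ l (h : l < 19) v, β l v = c v ⟨l + 1, by omega⟩ := by
    intro l h v
    simp only [β, t, if_pos h, bitIndex_of_lt h, Bool.xor_false]
  have hβge : ∀ i v, β (19 + i) v = (c v 19 ^^ j i (pr v)) := by
    intro i v
    simp only [β, t, if_neg (by omega : ¬ 19 + i < 19), bitIndex_of_le (by omega : 19 ≤ 19 + i),
      Nat.add_sub_cancel_left]
  have hβ0 : ∀ v, β 0 v = c v 1 := fun v => hβlt 0 (by omega) v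
  have hprx : ∀ u v, pr u = pr v → u ≠ v → x u ≠ x v := by
    intro u v h hne hx
    have h1 := hce u v h 0
    have h2 : e u ≠ e v := fun h' => hne (hpe u v h h')
    simp only [x] at hx
    rw [hx] at h1
    exact h2 (Bool.xor_right_inj.1 h1)
  -- `E` is the unit in which deviations are measured. The tolerance `2⁻²¹` is chosen so that,
  -- despite rounding, the error is at most `E`.
  obtain ⟨E, hE⟩ : ∃ E, E = d / 2 ^ 20 := ⟨_, rfl⟩
  have hE1 : 1 ≤ E := by rw [hE]; exact (Nat.one_le_div_iff (by positivity)).2 hd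
  have hdE : d ≤ 2 ^ 21 * E := by norm_num at hE ⊢; omega
  have hεE : (1 / 2 : ℝ) ^ 21 * d ≤ E := by
    have : (d : ℝ) ≤ 2 ^ 21 * E := by exact_mod_cast hdE
    rw [one_div, inv_pow, inv_mul_le_iff₀ (by positivity)]
    exact this
  have hεd : (1 / 2 : ℝ) ^ 21 * d ≤ d / 1000 := by
    have : (0 : ℝ) ≤ d := Nat.cast_nonneg d
    norm_num
    linarith
  have htri' : ∀ l < K, l ≠ 0 → ∀ v α γ δ,
      |(degIn G v {u | x u = α ∧ β 0 u = γ ∧ β l u = δ} : ℝ) - d / 8| ≤ d / 1000 := by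
    intro l hl hl0 v α γ δ
    simp only [hβ0]
    exact (htri v l hl hl0 α γ δ).trans hεd
  let F : ℕ → SimpleGraph V := fun l =>
    { Adj := fun u v => G.Adj u v ∧ x u = x v ∧ (∀ i < l, β i u = β i v) ∧ β l u ≠ β l v
      symm := ⟨fun u v h => ⟨h.1.symm, h.2.1.symm, fun i hi => (h.2.2.1 i hi).symm,
        h.2.2.2.symm⟩⟩
      loopless := ⟨fun u h => h.1.ne rfl⟩ }
  have hL : LevelSystem G d K x β := by
    refine ⟨hmix, hG, ?_, ?_⟩
    · let σ : Equiv.Perm V := (φ.trans ((Equiv.refl P).prodCongr Equiv.boolNot)).trans φ.symm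
      have hσp : ∀ v, pr (σ v) = pr v := by intro v; simp [σ, pr]
      have hσe : ∀ v, e (σ v) = !e v := by intro v; simp [σ, e]
      have hσc : ∀ v i, c (σ v) i = !c v i := by
        intro v i
        have := hce (σ v) v (hσp v) i
        rw [hσe] at this
        revert this
        cases c (σ v) i <;> cases c v i <;> cases e v <;> simp
      refine ⟨σ, fun v => hσc v 0, fun l _ v => ?_⟩
      simp only [β, hσc, hσp, Bool.not_xor]
    · intro l hl v α γ
      have hsplit : ∀ (b b' : V → Bool), degIn G v {u | x u = α ∧ b u = γ} =
          degIn G v {u | x u = α ∧ b u = γ ∧ b' u = true} +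
          degIn G v {u | x u = α ∧ b u = γ ∧ b' u = false} := by
        intro b b'
        rw [← degIn_union]
        · congr 1
          ext u
          simp only [mem_filter, mem_univ, true_and, mem_union]
          cases b' u <;> simp
        · rw [disjoint_filter]
          intro u _ h1 h2
          rw [h1.2.2] at h2
          simp at h2
      -- A quadrant consists of two triple parts, each at least `d / 8 - d / 1000`, which gives
      -- `0.248 * d`. For `l = 0` any other level can serve as the third bipartition.
      by_cases hl0 : l = 0
      · subst hl0
        have h1 := htri' 1 (by omega) (by omega) v α γ true
        have h2 := htri' 1 (by omega) (by omega) v α γ false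
        rw [hsplit _ (β 1)]
        push_cast
        rw [abs_le] at h1 h2
        linarith [h1.1, h2.1]
      · have h1 := htri' l hl hl0 v α true γ
        have h2 := htri' l hl hl0 v α false γ
        rw [hsplit _ (β 0)]
        simp only [and_comm (a := β l _ = γ)]
        push_cast
        rw [abs_le] at h1 h2
        linarith [h1.1, h2.1]
  have hsamec : ∀ u v l, 19 ≤ l → x u = x v → (∀ i < l, β i u = β i v) → ∀ i, c u i = c v i := by
    intro u v l hl hx hβ i
    by_cases hi : i = 0
    · rw [hi]; exact hx
    · have hi0 : (i : ℕ) ≠ 0 := fun h => hi (Fin.ext h)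
      have h1 := hβ (i - 1) (by omega)
      rw [hβlt _ (by omega), hβlt _ (by omega)] at h1
      have h2 : (⟨(i : ℕ) - 1 + 1, by omega⟩ : Fin 20) = i := Fin.ext (by simp; omega)
      rwa [h2] at h1
  -- Vertices not separated by the first 19 levels agree on bit 19, so after that separation depends
  -- on the labels alone.
  have hsamej : ∀ u v k, x u = x v → (∀ i < 19 + k, β i u = β i v) →
      ∀ i < k, j i (pr u) = j i (pr v) := by
    intro u v k hx hβ i hi
    have h1 := hβ (19 + i) (by omega)
    rw [hβge, hβge, hsamec u v _ (by omega) hx hβ 19] at h1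
    exact Bool.xor_right_inj.1 h1
  have hdegJ : ∀ k v, deg (F (19 + k)) v ≤ 2 * d / 2 ^ k := by
    intro k v
    rw [Nat.le_div_iff_mul_le (by positivity), mul_comm]
    refine le_trans (Nat.mul_le_mul_left _ ?_) (hj k v)
    classical
    unfold deg degIn
    refine card_le_card fun u hu => ?_
    simp only [mem_filter, mem_univ, true_and] at hu ⊢
    have h : (F (19 + k)).Adj u v := hu.symm
    exact ⟨⟨fun h' => hprx u v h' h.1.ne h.2.1, hsamej u v k h.2.1 h.2.2.1⟩, hu.1⟩
  have hdegE : ∀ l, 19 ≤ l → ∀ v, deg (F l) v ≤ 3 * E := by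
    intro l hl v
    have h1 := (abs_le.1 (hpre v (c v) 20 le_rfl)).2
    have h2 : deg (F l) v ≤ degIn G v {u | ∀ i : Fin 20, (i : ℕ) < 20 → c u i = c v i} := by
      classical
      unfold deg degIn
      refine card_le_card fun u hu => ?_
      simp only [mem_filter, mem_univ, true_and] at hu ⊢
      have h : (F l).Adj u v := hu.symm
      exact ⟨fun i _ => hsamec u v l hl h.2.1 h.2.2.1 i, hu.1⟩
    have h3 : (d : ℝ) / 2 ^ 20 ≤ 2 * E := by
      have : (d : ℝ) ≤ 2 ^ 21 * E := by exact_mod_cast hdE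
      rw [div_le_iff₀ (by positivity)]
      linarith
    have h4 : (deg (F l) v : ℝ) ≤ 3 * E := by
      have : (deg (F l) v : ℝ) ≤
          degIn G v {u | ∀ i : Fin 20, (i : ℕ) < 20 → c u i = c v i} := by exact_mod_cast h2
      linarith
    exact_mod_cast h4
  have hdegP : ∀ l < 19, ∀ v, |(deg (F l) v : ℝ) - d / 2 ^ (l + 2)| ≤ E := by
    intro l hl v
    have h1 := (hpre v (fun i => if (i : ℕ) = l + 1 then !c v i else c v i) (l + 2)
      (by omega)).trans hεE
    have h2 : deg (F l) v = degIn G v {u | ∀ i : Fin 20, (i : ℕ) < l + 2 →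
        c u i = if (i : ℕ) = l + 1 then !c v i else c v i} := by
      classical
      unfold deg degIn
      congr 1
      ext u
      simp only [F, mem_filter, mem_univ, true_and]
      constructor
      · rintro ⟨h1, h2, h3, h4⟩
        refine ⟨fun i hi => ?_, h1⟩
        split_ifs with hil
        · rw [hβlt l hl, hβlt l hl] at h4
          have : i = ⟨l + 1, by omega⟩ := Fin.ext hil
          rw [this]
          revert h4
          cases c u ⟨l + 1, by omega⟩ <;> cases c v ⟨l + 1, by omega⟩ <;> simp
        · by_cases hi0 : i = 0
          · rw [hi0]; exact h2.symm
          · have hi0' : (i : ℕ) ≠ 0 := fun h => hi0 (Fin.ext h)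
            have h5 := h3 (i - 1) (by omega)
            rw [hβlt _ (by omega), hβlt _ (by omega)] at h5
            have h6 : (⟨(i : ℕ) - 1 + 1, by omega⟩ : Fin 20) = i := Fin.ext (by simp; omega)
            rw [h6] at h5
            exact h5.symm
      · rintro ⟨h1, h2⟩
        refine ⟨h2, ?_, fun i hi => ?_, ?_⟩
        · have := h1 0 (by simp)
          rw [if_neg (by simp)] at this
          exact this.symm
        · have := h1 ⟨i + 1, by omega⟩ (by simp; omega)
          rw [if_neg (by simp; omega)] at this
          rw [hβlt i (by omega), hβlt i (by omega)]
          exact this.symm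
        · have := h1 ⟨l + 1, by omega⟩ (by simp)
          rw [if_pos rfl] at this
          rw [hβlt l hl, hβlt l hl, this]
          simp
    rw [h2]
    exact h1
  have hmain := hL.exists_decomposition hd0 (by omega) F
    (fun l => if l < 19 then 2 * E else min (3 * E) (2 * d / 2 ^ (l - 19)))
    (fun l _ u v h => h.1) (fun l _ u v h => ⟨h.2.1, h.2.2.2⟩)
    (fun u v h1 h2 h3 => ⟨h1, h2, by simp, h3⟩) ?_ ?_ ?_ htri' ?_
  · rw [show 22 + Nat.log 2 d = K + 1 by omega]
    exact hmain
  · have hlt : ∀ i k, i < k → Disjoint (F i) (F k) := by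
      intro i k hik
      rw [disjoint_iff_inf_le]
      intro u v h
      exact h.1.2.2.2 (h.2.2.2.1 i hik)
    intro i _ k _ hik
    rcases lt_or_gt_of_ne hik with h | h
    · exact hlt i k h
    · exact (hlt k i h).symm
  · intro u v huv hx
    have hex : ∃ l, l < K ∧ β l u ≠ β l v := by
      by_contra hno
      push Not at hno
      -- A surviving edge joins distinct pairs, since partners differ in `x`. It would force `2 ^ m
      -- ≤ 2 * d`, whereas `m = Nat.log 2 d + 2` makes `2 ^ m > 2 * d`.
      have h1 := hsamej u v m hx (by rw [← hKm]; exact hno)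
      have h2 := hj m v
      have h3 : 0 < degIn G v {u | pr u ≠ pr v ∧ ∀ i < m, j i (pr u) = j i (pr v)} := by
        classical
        unfold degIn
        refine card_pos.2 ⟨u, ?_⟩
        simp only [mem_filter, mem_univ, true_and]
        exact ⟨⟨fun h => hprx u v h huv.ne hx, h1⟩, huv.symm⟩
      have h4 : d < 2 ^ (Nat.log 2 d + 1) := Nat.lt_pow_succ_log_self (by norm_num) d
      have h5 : 2 ^ m = 2 * 2 ^ (Nat.log 2 d + 1) := by rw [hm]; ring
      have h6 := Nat.mul_le_mul_left (2 ^ m) h3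
      omega
    classical
    refine ⟨Nat.find hex, (Nat.find_spec hex).1, huv, hx, fun i hi => ?_, (Nat.find_spec hex).2⟩
    have := Nat.find_min hex hi
    push Not at this
    exact this (hi.trans (Nat.find_spec hex).1)
  · intro l hl u v
    by_cases h19 : l < 19
    · rw [if_pos h19]
      have h1 := (abs_le.1 (hdegP l h19 u)).2
      have h2 := (abs_le.1 (hdegP l h19 v)).1
      have h3 : (deg (F l) u : ℝ) ≤ deg (F l) v + 2 * E := by linarith
      exact_mod_cast h3
    · rw [if_neg h19]
      have h1 := hdegE l (by omega) u
      have h2 := hdegJ (l - 19) u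
      rw [show 19 + (l - 19) = l by omega] at h2
      exact (le_min h1 h2).trans (Nat.le_add_left _ _)
  · rw [hKm]
    exact sum_level_spread_le hE m

end PairedBits

/-- The factor before the exponential is at most a constant times `d ^ 3`, and exponential decay
beats it. -/
theorem exists_threshold : ∃ d₀ : ℕ, 2 ^ 20 ≤ d₀ ∧ ∀ d : ℕ, d₀ ≤ d →
    16 * (d : ℝ) ^ 2 * (21 * 2 ^ 20 + 8 * (21 + Nat.log 2 d : ℕ)) *
      Real.exp (-(((1 / 2) ^ 21) ^ 2 * d / 16)) ≤ 1 := by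
  obtain ⟨a, ha0, ha⟩ : ∃ a : ℝ, 0 < a ∧ ((1 / 2 : ℝ) ^ 21) ^ 2 / 16 = a :=
    ⟨_, by positivity, rfl⟩
  have hlim := (Real.tendsto_pow_mul_exp_neg_atTop_nhds_zero 3).comp
    (Filter.Tendsto.const_mul_atTop ha0 tendsto_natCast_atTop_atTop)
  have hev := hlim.eventually (ge_mem_nhds (show (0 : ℝ) < a ^ 3 / 2 ^ 30 by positivity))
  obtain ⟨d₁, hd₁⟩ := Filter.eventually_atTop.1 hev
  refine ⟨max d₁ (2 ^ 20), le_max_right _ _, fun d hd => ?_⟩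
  have h1 : (a * d) ^ 3 * Real.exp (-(a * d)) ≤ a ^ 3 / 2 ^ 30 :=
    hd₁ d ((le_max_left _ _).trans hd)
  have hd1 : 1 ≤ d := le_trans (by norm_num) ((le_max_right _ _).trans hd)
  have h2 : ((21 * 2 ^ 20 + 8 * (21 + Nat.log 2 d : ℕ) : ℕ) : ℝ) ≤ (2 ^ 26 * d : ℕ) := by
    have := Nat.log_le_self 2 d
    norm_num
    exact_mod_cast (by omega : 22020096 + 8 * (21 + Nat.log 2 d) ≤ 67108864 * d)
  have h3 : -(((1 / 2 : ℝ) ^ 21) ^ 2 * d / 16) = -(a * d) := by rw [← ha]; ring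
  rw [h3]
  push_cast at h2 ⊢
  calc 16 * (d : ℝ) ^ 2 * (21 * 2 ^ 20 + 8 * (21 + Nat.log 2 d)) * Real.exp (-(a * d))
      ≤ 16 * (d : ℝ) ^ 2 * (2 ^ 26 * d) * Real.exp (-(a * d)) := by
        gcongr
        linarith
    _ = 2 ^ 30 / a ^ 3 * ((a * d) ^ 3 * Real.exp (-(a * d))) := by
        field_simp
        ring
    _ ≤ 2 ^ 30 / a ^ 3 * (a ^ 3 / 2 ^ 30) := by gcongr
    _ = 1 := by field_simp

end RegBip

theorem theorem1p3 :
    ∃ d₀ : ℕ, 0 < d₀ ∧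
      ∀ d : ℕ, d₀ ≤ d →
        ∀ n : ℕ, Even n → d + 1 ≤ n →
          ∀ (G : SimpleGraph (Fin n)) (lam : ℝ),
            RegBip.IsNDLambdaGraph G n d lam → lam ≤ (d : ℝ) / 12 →
              ∃ (k : ℕ) (H : Fin k → SimpleGraph (Fin n)),
                (k : ℝ) ≤ Real.logb 2 (d : ℝ) + 36 ∧
                  RegBip.IsRegularBipartiteDecomposition G H := by
  obtain ⟨d₀, hd₀, hsize⟩ := RegBip.exists_threshold
  refine ⟨d₀, lt_of_lt_of_le (by norm_num) hd₀, fun d hd n hn hdn G lam hG hlam => ?_⟩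
  have hd20 : 2 ^ 20 ≤ d := hd₀.trans hd
  have hd0 : 0 < d := lt_of_lt_of_le (by norm_num) hd20
  have hd0' : (0 : ℝ) < d := by exact_mod_cast hd0
  obtain ⟨r, hr⟩ := hn
  have hreg := (RegBip.isRegularGraph_iff G d).1 hG.regular
  have : Nonempty (Fin n) := ⟨⟨0, by omega⟩⟩
  have hmix : RegBip.IsMixing G d := by
    intro S T
    rw [Fintype.card_fin]
    exact RegBip.expander_mixing (by omega) G hreg (hG.secondEigenvalue_le.trans hlam)
      (by linarith) S T
  obtain ⟨H, hH⟩ := RegBip.exists_decomposition_of_isMixing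
    (Fintype.equivOfCardEq (by simp; omega) : Fin n ≃ Fin r × Bool) G hd20 hreg hmix
    (hsize d hd)
  refine ⟨_, H, ?_, hH⟩
  have := Real.natLog_le_logb d 2
  push_cast at this ⊢
  linarith
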